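/- For elements $x_1,x_2,\dots$ of a group $G$ put $[x_1,x_2]=x_1^{-1}x_2^{-1}x_1x_2$ and $[x_1,\dots,x_\ell]=[[x_1,\dots,x_{\ell-1}],x_\ell]$ (with $[x_1]=x_1$). An element of the form $[x_1,\dots,x_\ell]$ is called a commutator of length $\ell$. Let $\mathcal D_\ell=\mathcal D_\ell(G)$ be the set of all commutators of length $\ell$ in $G$ whose order (in $\mathbb N\cup\{\infty\}$) is maximal among the orders of all commutators of length $\ell$ in $G$, and let $D=\langle\mathcal D_\ell\rangle$. A group is called $r$-generator if it can be generated by $r$ elements (not necessarily distinct), and $\gamma_\ell(M)$ denotes the $\ell$-th term of the lower central series of a group $M$, with $\gamma_1(M)=M$. Fix $x_1,\dots,x_\ell\in G$ and let $d=[x_1,\dots,x_\ell]$. For $I\subseteq\{1,\dots,\ell\}$ and elements $y_i\in G$ $(i\in I)$, let $\varphi_I(y_i)=[z_1,\dots,z_\ell]$, where $z_i=y_i$ if $i\in I$ and $z_i=x_i$ if $i\notin I$; for $N\le G$ write $\varphi_I(N)=1$ if $\varphi_I(y_i)=1$ for all choices of $y_i\in N$. We say that $G$ is $d$-stable (with respect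 to $x_1,\dots,x_\ell$) if, for every $k\in\{0,\dots,\ell\}$ and every normal subgroup $N$ of $G$ such that $N\le C_G(d)$ and $\varphi_I(N)=1$ for every non-empty $I\subseteq\{k+1,\dots,\ell\}$, we have $$\varphi_{\{k\}\cup I}(x_iy_i)\in D$$ for every $I\subseteq\{k+1,\dots,\ell\}$ and all $y_k,\dots,y_\ell\in N$ (where for $k=0$ the symbol $\varphi_{\{0\}\cup I}$ means $\varphi_I$). **Theorem 4.5.** For all integers $\ell\ge 1$ and $m,r\ge 0$ there is a number $B=B(m,\ell,r)$ with the following property. Let $G$ be an $r$-generator group with $|\mathcal D_\ell|=m$, let $x_1,\dots,x_\ell\in G$ be such that $d=[x_1,\dots,x_\ell]\in\mathcal D_\ell$, and assume that $G$ is $d$-stable with respect to $x_1,\dots,x_\ell$. Then $G$ contains a subgroup $M$ of finite index at most $B$ such that $\gamma_\ell(M)=1$. -/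

import Mathlib

namespace LongComm

variable {G : Type*} [Group G]

/-- The group commutator in the convention `[a, b] = a⁻¹ b⁻¹ a b`
(Mathlib's bracket is `a b a⁻¹ b⁻¹`). -/
def comm (a b : G) : G := a⁻¹ * b⁻¹ * a * b

/-- The left-normed commutator `[x₁, …, x_ℓ] = [[… [x₁, x₂], …], x_ℓ]`, with `[x₁] = x₁`
(and the value `1` for the empty tuple). The entry `x_j` is stored at position `j - 1`. -/
def longComm : (l : ℕ) → (Fin l → G) → G
  | 0, _ => 1
  | 1, x => x 0
  | l + 2, x => comm (longComm (l + 1) fun i => x i.castSucc) (x (Fin.last (l + 1)))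

variable (G) in
/-- The set of all commutators of length `l` in `G`. -/
def longComms (l : ℕ) : Set G := Set.range (longComm (G := G) l)

/-- The order of an element, as an element of `ℕ ∪ {∞}`. -/
noncomputable def eorder (g : G) : ℕ∞ := ENat.card (Subgroup.zpowers g)

variable (G) in
/-- `𝒟_l`: the commutators of length `l` whose order is maximal among the orders of all
commutators of length `l` in `G`. -/
def maxComms (l : ℕ) : Set G :=
  {d | d ∈ longComms G l ∧ ∀ c ∈ longComms G l, eorder c ≤ eorder d}

/-- `φ_I(y)`, relative to the base tuple `x`: the commutator of length `l` whose `j`-th entry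
(`1 ≤ j ≤ l`) is `y_j` if `j ∈ I` and `x_j` otherwise. -/
def subst {l : ℕ} (x : Fin l → G) (I : Finset ℕ) (y : Fin l → G) : G :=
  longComm l fun i => if (i : ℕ) + 1 ∈ I then y i else x i

/-- `G` is `d`-stable, where `d = [x₁, …, x_l]`: whenever `0 ≤ k ≤ l` and `N` is a normal subgroup
of `G` centralizing `d` such that `φ_I(N) = 1` for all non-empty `I ⊆ {k + 1, …, l}`, one has
`φ_{{k} ∪ I}(x_i y_i) ∈ ⟨𝒟_l⟩` for all `I ⊆ {k + 1, …, l}` and all `y_i ∈ N`. (Index `0` labels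
no entry, so that `φ_{{0} ∪ I} = φ_I`.) -/
def IsStable {l : ℕ} (x : Fin l → G) : Prop :=
  ∀ k ≤ l, ∀ N : Subgroup G, N.Normal →
    N ≤ Subgroup.centralizer {longComm l x} →
    (∀ I ⊆ Finset.Icc (k + 1) l, I.Nonempty →
      ∀ y : Fin l → G, (∀ i, y i ∈ N) → subst x I y = 1) →
    ∀ I ⊆ Finset.Icc (k + 1) l, ∀ y : Fin l → G, (∀ i, y i ∈ N) →
      subst x (insert k I) (fun i => x i * y i) ∈ Subgroup.closure (maxComms G l)

variable (G) in
/-- `G` can be generated by `r` elements (repetitions allowed, so: by at most `r` elements when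
`r` is positive). -/
def IsGeneratedBy (r : ℕ) : Prop :=
  ∃ g : Fin r → G, Subgroup.closure (Set.range g) = ⊤

end LongComm

/-! Start with `N = C_G(𝒟_l)`, a normal subgroup of index at most `m!`, and shrink it until every
substitution of elements of `N` into `(x₁, …, x_l)` gives the trivial commutator (`KilledAfter`).
The entries are treated from the last to the first. Once the first entry is reached, all `[n, n₂, …,
n_l]` with entries in `N` are trivial, so `γ_l(N) = 1`.

One step (`KilledAfter.step`) treats position `k`. As substitutions at later positions already give
`1`, replacing `x_k` by a suitable `x_k n'` and the later `x_i` by `z_i ∈ x_i N` produces exactly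
`[x₁, …, x_{k-1}, n, z_{k+1}, …, z_l] d` (`KilledAfter.exists_listComm_eq`). Stability puts this in
`D`, so the first factor lies in `D ∩ N`, which is central in `N`. Therefore `[x₁, …, x_{k-1}, n]`
lies in a bounded term of the upper central series of `N`, and by Lazard–Leibman the factor
belonging to `n ^ j` is a polynomial sequence `F j` of bounded degree with values in an abelian
group (`seqDiff_iterate_foldl`).

Each `F j * d` is a commutator of length `l`, so its order is at most that of `d`, with equality for
at most `m` values. This forces the values of `F` to have order dividing a bounded number `e`
(`polyExp_smul_eq_zero_of_addOrderOf_le`). Substitution of `n` is a homomorphism into an abelian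
group of exponent `e`, modulo errors controlled by induction, so repeatedly passing from `N` to `N^e
[N, N]` makes the values trivial (`tail_bot_of_mem_verb`). The index stays bounded because `G` is
`r`-generator. -/

namespace LongComm

/-! ### Polynomial sequences in abelian groups and orders of their values. -/

section Abelian

open Finset

variable {A : Type*} [AddCommGroup A]

/-- Polynomial functions of degree at most `q` with coefficients in an abelian group. -/
def IsPoly : ℕ → (ℕ → A) → Prop
  | 0, F => ∃ b, ∀ j, F j = b
  | q + 1, F => ∃ b F', IsPoly q F' ∧ ∀ j, F j = b + (j : ℤ) • F' j

theorem isPoly_const (q : ℕ) (b : A) : IsPoly q fun _ => b := by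
  induction q generalizing b with
  | zero => exact ⟨b, fun _ => rfl⟩
  | succ q ih => exact ⟨b, fun _ => 0, ih 0, fun j => by simp⟩

theorem IsPoly.succ {q : ℕ} {F : ℕ → A} (h : IsPoly q F) : IsPoly (q + 1) F := by
  induction q generalizing F with
  | zero =>
    obtain ⟨b, hb⟩ := h
    exact ⟨b, fun _ => 0, isPoly_const 0 0, fun j => by simp [hb]⟩
  | succ q ih =>
    obtain ⟨b, F', h', hb⟩ := h
    exact ⟨b, F', ih h', hb⟩

theorem IsPoly.mono {q r : ℕ} (hqr : q ≤ r) {F : ℕ → A} (h : IsPoly q F) : IsPoly r F := by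
  induction r, hqr using Nat.le_induction with
  | base => exact h
  | succ r _ ih => exact ih.succ

theorem IsPoly.add {q : ℕ} {F F' : ℕ → A} (h : IsPoly q F) (h' : IsPoly q F') :
    IsPoly q fun j => F j + F' j := by
  induction q generalizing F F' with
  | zero =>
    obtain ⟨b, hb⟩ := h
    obtain ⟨b', hb'⟩ := h'
    exact ⟨b + b', fun j => by beta_reduce; rw [hb, hb']⟩
  | succ q ih =>
    obtain ⟨b, f, hf, hb⟩ := h
    obtain ⟨b', f', hf', hb'⟩ := h'
    exact ⟨b + b', fun j => f j + f' j, ih hf hf', fun j => by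
      beta_reduce; rw [hb, hb', smul_add]; abel⟩

theorem IsPoly.zsmul {q : ℕ} {F : ℕ → A} (h : IsPoly q F) (a : ℤ) :
    IsPoly q fun j => a • F j := by
  induction q generalizing F with
  | zero =>
    obtain ⟨b, hb⟩ := h
    exact ⟨a • b, fun j => by beta_reduce; rw [hb]⟩
  | succ q ih =>
    obtain ⟨b, f, hf, hb⟩ := h
    exact ⟨a • b, fun j => a • f j, ih hf, fun j => by
      beta_reduce; rw [hb, smul_add, smul_comm]⟩

theorem isPoly_sum {ι : Type*} (s : Finset ι) {q : ℕ} {F : ι → ℕ → A}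
    (h : ∀ i ∈ s, IsPoly q (F i)) : IsPoly q fun j => ∑ i ∈ s, F i j := by
  classical
  induction s using Finset.induction_on with
  | empty => simpa using isPoly_const q (0 : A)
  | insert i s hi ih =>
    simp only [Finset.sum_insert hi]
    exact (h i (Finset.mem_insert_self _ _)).add
      (ih fun k hk => h k (Finset.mem_insert_of_mem hk))

theorem IsPoly.linear_smul {q : ℕ} {F : ℕ → A} (h : IsPoly q F) (a : ℤ) :
    IsPoly (q + 1) fun j => ((j : ℤ) - a) • F j := by
  have h1 : IsPoly (q + 1) fun j => (j : ℤ) • F j := ⟨0, F, h, fun j => by simp⟩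
  have h2 := h1.add (h.zsmul (-a)).succ
  refine cast (congrArg _ (funext fun j => ?_)) h2
  rw [← add_smul, sub_eq_add_neg]

theorem isPoly_descFactorial_smul (i : ℕ) (c : A) :
    IsPoly i fun j => (j.descFactorial i : ℤ) • c := by
  induction i with
  | zero => exact ⟨c, fun j => by simp⟩
  | succ i ih =>
    refine cast (congrArg _ (funext fun j => ?_)) (ih.linear_smul i)
    rw [smul_smul, Nat.descFactorial_succ]
    rcases le_or_gt i j with h | h
    · push_cast [h]; rfl
    · simp [Nat.descFactorial_of_lt h]

/-- Newton's formula writes `F` with binomial coefficients `C(j, k)`, `k ≤ q`; multiplying by `q!`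
turns them into integer polynomials in `j`. -/
theorem isPoly_factorial_smul {q : ℕ} {F : ℕ → A} (h : (fwdDiff 1)^[q + 1] F = 0) :
    IsPoly q fun j => (q.factorial : ℤ) • F j := by
  have hz : ∀ k, q < k → (fwdDiff 1)^[k] F = 0 := by
    intro k hk
    induction k, Nat.succ_le_of_lt hk using Nat.le_induction with
    | base => exact h
    | succ k hk' ih =>
      rw [Function.iterate_succ_apply', ih (by omega)]
      ext; simp [fwdDiff]
  have key : ∀ j, F j = ∑ k ∈ range (q + 1), j.choose k • (fwdDiff 1)^[k] F 0 := by
    intro j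
    have h1 := shift_eq_sum_fwdDiff_iter (1 : ℕ) F j 0
    simp only [smul_eq_mul, mul_one, zero_add] at h1
    rw [h1]
    have e1 : ∀ n, (∀ k, n ≤ k → j.choose k • (fwdDiff 1)^[k] F 0 = 0) →
        ∀ m, n ≤ m → ∑ k ∈ range m, j.choose k • (fwdDiff 1)^[k] F 0 =
          ∑ k ∈ range n, j.choose k • (fwdDiff 1)^[k] F 0 := by
      intro n hn m hm
      refine (Finset.sum_subset (by simpa using hm) fun k _ hk => hn k (by simpa using hk)).symm
    rcases le_total (j + 1) (q + 1) with hle | hle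
    · exact (e1 (j + 1) (fun k hk => by rw [Nat.choose_eq_zero_of_lt hk, zero_smul]) _ hle).symm
    · exact e1 (q + 1) (fun k hk => by rw [hz k hk]; simp) _ hle
  have h2 : IsPoly q fun j => ∑ k ∈ range (q + 1),
      (j.descFactorial k : ℤ) • ((q.factorial / k.factorial : ℕ) : ℤ) • (fwdDiff 1)^[k] F 0 :=
    isPoly_sum _ fun k hk =>
      (isPoly_descFactorial_smul k _).mono (Nat.lt_succ_iff.1 (Finset.mem_range.1 hk))
  refine cast (congrArg _ (funext fun j => ?_)) h2
  conv_rhs => rw [key j, Finset.smul_sum]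
  refine Finset.sum_congr rfl fun k hk => ?_
  rw [← natCast_zsmul ((fwdDiff 1)^[k] F 0) (j.choose k), smul_smul, smul_smul]
  congr 1
  rw [Nat.descFactorial_eq_factorial_mul_choose]
  have := Nat.div_mul_cancel (Nat.factorial_dvd_factorial (Nat.lt_succ_iff.1 (Finset.mem_range.1 hk)))
  have h3 : ((q.factorial / k.factorial : ℕ) : ℤ) * (k.factorial : ℤ) = q.factorial := by
    exact_mod_cast this
  rw [← h3]; push_cast; ring

/-- The factor theorem: `j - a` is monic, so no division in `A` is needed. -/
theorem IsPoly.exists_eq_linear_smul {q : ℕ} {F : ℕ → A} (h : IsPoly (q + 1) F) {a : ℕ}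
    (ha : F a = 0) : ∃ F', IsPoly q F' ∧ ∀ j, F j = ((j : ℤ) - a) • F' j := by
  induction q generalizing F with
  | zero =>
    obtain ⟨b, F', ⟨c, hc⟩, hF⟩ := h
    refine ⟨fun _ => c, ⟨c, fun _ => rfl⟩, fun j => ?_⟩
    have : b = -((a : ℤ) • c) := by rw [hF, hc] at ha; exact eq_neg_of_add_eq_zero_left ha
    rw [hF, hc, this, sub_smul]; abel
  | succ q ih =>
    obtain ⟨b, F', hF', hF⟩ := h
    have hb : b = -((a : ℤ) • F' a) := by rw [hF] at ha; exact eq_neg_of_add_eq_zero_left ha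
    obtain ⟨F₂, h₂, e₂⟩ := ih (F := fun j => F' j + -F' a) (hF'.add (isPoly_const _ _)) (by simp)
    refine ⟨fun j => F' j + (a : ℤ) • F₂ j, hF'.add (h₂.succ.zsmul a), fun j => ?_⟩
    have e := e₂ j
    rw [hF, hb, smul_add, smul_comm, ← e, smul_add, sub_smul, smul_neg]
    abel

/-- A polynomial function of degree at most `q` with `q + 1` zeros in `{0, …, X}` is killed
by a number depending only on `q` and `X`. -/
theorem IsPoly.smul_eq_zero_of_zeros {X : ℕ} {q : ℕ} {F : ℕ → A} (h : IsPoly q F) (S : Finset ℕ)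
    (hS : ∀ j ∈ S, j ≤ X) (hc : S.card = q + 1) (hz : ∀ j ∈ S, F j = 0) (j : ℕ) :
    ((X.factorial : ℤ) ^ q) • F j = 0 := by
  induction q generalizing F S with
  | zero =>
    obtain ⟨b, hb⟩ := h
    obtain ⟨a, ha⟩ := Finset.card_pos.1 (by omega : 0 < S.card)
    rw [hb, ← hb a, hz a ha, smul_zero]
  | succ q ih =>
    obtain ⟨a, ha⟩ := Finset.card_pos.1 (by omega : 0 < S.card)
    obtain ⟨F', hF', e⟩ := h.exists_eq_linear_smul (hz a ha)
    -- At another zero `i` only `(i - a) • F' i = 0` is known. Since `|i - a| ≤ X`, the multiple `X!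
    -- • F'` does vanish there.
    have hdvd : ∀ i ∈ S, i ≠ a → ((i : ℤ) - a) ∣ (X.factorial : ℤ) := by
      intro i hi hia
      have h1 : ((i : ℤ) - a).natAbs ∣ X.factorial := by
        refine Nat.dvd_factorial ?_ ?_
        · have : ((i : ℤ) - a) ≠ 0 := by
            rw [sub_ne_zero]; exact_mod_cast hia
          omega
        · have := hS i hi
          have := hS a ha
          omega
      exact Int.natAbs_dvd.1 (by exact_mod_cast h1)
    have h3 := ih (hF'.zsmul X.factorial) (S.erase a) (fun i hi => hS i (Finset.mem_of_mem_erase hi))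
      (by rw [Finset.card_erase_of_mem ha, hc]; rfl) (fun i hi => by
        obtain ⟨c, hc⟩ := hdvd i (Finset.mem_of_mem_erase hi) (Finset.ne_of_mem_erase hi)
        rw [hc, mul_comm, mul_smul, ← e, hz i (Finset.mem_of_mem_erase hi), smul_zero])
    rw [e, smul_comm, pow_succ, mul_smul, h3, smul_zero]

theorem fwdDiff_eq_zero_iff {F : ℕ → A} : fwdDiff 1 F = 0 ↔ ∀ j, F j = F 0 := by
  constructor
  · intro h j
    induction j with
    | zero => rfl
    | succ j ih => rw [← ih]; exact sub_eq_zero.1 (congrFun h j)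
  · intro h
    ext j
    simp only [fwdDiff, Pi.zero_apply]
    rw [h (j + 1), h j, sub_self]

theorem eq_zero_of_consecutive_zeros {q : ℕ} {F : ℕ → A} (h : (fwdDiff 1)^[q + 1] F = 0) {i : ℕ}
    (hi : ∀ t ≤ q, F (i + t) = 0) : ∀ j, F j = 0 := by
  induction q generalizing F with
  | zero =>
    have h' := fwdDiff_eq_zero_iff.1 h
    intro j
    rw [h' j, ← h' (i + 0), hi 0 le_rfl]
  | succ q ih =>
    have h1 : ∀ j, fwdDiff 1 F j = 0 := ih (F := fwdDiff 1 F) h fun t ht => by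
      have := hi (t + 1) (by omega)
      simp only [fwdDiff]
      rw [add_assoc, this, hi t (by omega), sub_zero]
    have h' := fwdDiff_eq_zero_iff.1 (funext h1)
    intro j
    rw [h' j, ← h' (i + 0), hi 0 (by omega)]

/-- The difference of `i ↦ F (u * i)` is a sum of `u` dilated shifts of the difference of `F`. -/
theorem fwdDiff_iter_dilate {q : ℕ} {F : ℕ → A} (h : (fwdDiff 1)^[q] F = 0) (u : ℕ) :
    (fwdDiff 1)^[q] (fun i => F (u * i)) = 0 := by
  induction q generalizing F with
  | zero =>
    have h' : F = 0 := h
    subst h'; rfl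
  | succ q ih =>
    have e : fwdDiff 1 (fun i => F (u * i)) =
        ∑ c ∈ range u, fun i => (fun r => fwdDiff 1 F (r + c)) (u * i) := by
      ext i
      simp only [fwdDiff, Finset.sum_apply]
      have := Finset.sum_range_sub (fun c => F (u * i + c)) u
      simp only [add_zero, ← add_assoc] at this
      rw [mul_add, mul_one, this]
    rw [Function.iterate_succ_apply, e, fwdDiff_iter_finsetSum]
    refine Finset.sum_eq_zero fun c _ => ih (F := fun r => fwdDiff 1 F (r + c)) ?_
    ext y
    rw [fwdDiff_iter_comp_add]
    exact congrFun h (y + c)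

/-- By induction the difference of `F` has period `s ^ q`, so `F (j + s ^ q) - F j` is constant; `s`
such steps add `s` times this constant, which is zero. -/
theorem eq_add_pow_of_smul_eq_zero {q s : ℕ} {F : ℕ → A} (h : (fwdDiff 1)^[q + 1] F = 0)
    (hs : ∀ j, s • F j = 0) (j : ℕ) : F (j + s ^ q) = F j := by
  induction q generalizing F j with
  | zero =>
    have h' := fwdDiff_eq_zero_iff.1 h
    rw [h' (j + _), h' j]
  | succ q ih =>
    have h1 := ih (F := fwdDiff 1 F) h fun j => by simp [fwdDiff, smul_sub, hs]
    have h2 : ∀ j, F (j + s ^ q) - F j = F (0 + s ^ q) - F 0 := by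
      refine (fwdDiff_eq_zero_iff (F := fun j => F (j + s ^ q) - F j)).1 ?_
      ext j
      have := h1 j
      simp only [fwdDiff, Pi.zero_apply] at this ⊢
      rw [add_right_comm, sub_eq_zero]
      rw [sub_eq_iff_eq_add] at this
      rw [this]; abel
    have h3 : ∀ k, F (j + k * s ^ q) = F j + k • (F (0 + s ^ q) - F 0) := by
      intro k
      induction k with
      | zero => simp
      | succ k ihk =>
        rw [add_mul, one_mul, ← add_assoc, add_smul, ← add_assoc, ← ihk, one_smul,
          ← h2 (j + k * s ^ q)]
        abel
    rw [pow_succ, mul_comm, h3, smul_sub, hs, hs, sub_zero, add_zero]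

theorem eq_of_modEq {q s : ℕ} {F : ℕ → A} (h : (fwdDiff 1)^[q + 1] F = 0)
    (hs : ∀ j, s • F j = 0) {i j : ℕ} (hij : i ≡ j [MOD s ^ q]) : F i = F j := by
  wlog hle : i ≤ j generalizing i j
  · exact (this hij.symm (le_of_not_ge hle)).symm
  obtain ⟨c, hc⟩ := (Nat.modEq_iff_dvd' hle).1 hij
  have : j = i + s ^ q * c := by omega
  subst this
  clear hij hc hle
  induction c with
  | zero => simp
  | succ c ih => rw [mul_add, mul_one, ← add_assoc, eq_add_pow_of_smul_eq_zero h hs, ih]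

/-- The exponent bounding the values of a polynomial function of degree at most `q` that takes at
most `m` values on a set meeting every interval of length `q + 1`. -/
def polyExp (m q : ℕ) : ℕ := q.factorial * (((q + 1) * (m * q + 1)).factorial) ^ q

theorem polyExp_pos (m q : ℕ) : 0 < polyExp m q :=
  Nat.mul_pos (Nat.factorial_pos _) (pow_pos (Nat.factorial_pos _) _)

/-- Choose a good point in each of `m * q + 1` blocks of length `q + 1`. By pigeonhole `q + 1` of
them share a value `w`, so `q! • (F - w)` has enough zeros for `polyExp m q` to kill `F - w`
everywhere; evaluating at `0` shows that it kills `w` as well. -/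
theorem polyExp_smul_eq_zero {m q : ℕ} {F : ℕ → A} (h : (fwdDiff 1)^[q + 1] F = 0) (h0 : F 0 = 0)
    (Good : ℕ → Prop) (hw : ∀ i, ∃ t ≤ q, Good (i + t)) (V : Finset A) (hV : V.card ≤ m)
    (hG : ∀ j, Good j → F j ∈ V) (j : ℕ) : polyExp m q • F j = 0 := by
  classical
  choose t ht hgood using hw
  set g : ℕ → ℕ := fun i => (q + 1) * i + t ((q + 1) * i) with hg
  have ginj : Function.Injective g := by
    intro a b hab
    simp only [hg] at hab
    have h1 := ht ((q + 1) * a)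
    have h2 := ht ((q + 1) * b)
    have e : ∀ c, ((q + 1) * c + t ((q + 1) * c)) / (q + 1) = c := fun c => by
      rw [Nat.mul_add_div (by omega), Nat.div_eq_of_lt (by have := ht ((q + 1) * c); omega), add_zero]
    rw [← e a, hab, e b]
  obtain ⟨w, -, hw⟩ := Finset.exists_lt_card_fiber_of_mul_lt_card_of_maps_to
    (s := range (m * q + 1)) (t := V) (f := fun i => F (g i)) (n := q)
    (fun i _ => hG _ (hgood _))
    (by rw [Finset.card_range]; exact Nat.lt_succ_of_le (Nat.mul_le_mul_right q hV))
  obtain ⟨S, hS, hcard⟩ := Finset.exists_subset_card_eq (Nat.succ_le_of_lt hw)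
  have hpoly : IsPoly q fun j => (q.factorial : ℤ) • F j + -((q.factorial : ℤ) • w) :=
    (isPoly_factorial_smul h).add (isPoly_const _ _)
  have key := hpoly.smul_eq_zero_of_zeros (X := (q + 1) * (m * q + 1)) (S.image g)
    (fun x hx => by
      obtain ⟨i, hi, rfl⟩ := Finset.mem_image.1 hx
      have h1 := Finset.mem_range.1 (Finset.mem_filter.1 (hS hi)).1
      have h2 := ht ((q + 1) * i)
      calc g i ≤ (q + 1) * i + (q + 1) := by simp only [hg]; omega
        _ = (q + 1) * (i + 1) := by ring
        _ ≤ _ := Nat.mul_le_mul_left _ h1)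
    (by rw [Finset.card_image_of_injective _ ginj, hcard])
    (fun x hx => by
      obtain ⟨i, hi, rfl⟩ := Finset.mem_image.1 hx
      have h1 : F (g i) = w := (Finset.mem_filter.1 (hS hi)).2
      rw [h1, add_neg_cancel])
  have key' : ∀ j, polyExp m q • F j = polyExp m q • w := by
    intro j
    have := key j
    rw [← sub_eq_add_neg, ← smul_sub, smul_smul, smul_sub, sub_eq_zero] at this
    rw [← natCast_zsmul, ← natCast_zsmul, polyExp]
    push_cast
    rw [mul_comm]
    exact this
  rw [key' j, ← key' 0, h0, smul_zero]

/-- The divisibilities say that `o` and `n` have the same part prime to `p`, so the smaller one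
contains a smaller power of `p`. -/
theorem dvd_div_of_lt {n o p b : ℕ} (hp : p.Prime) (hn : n ≠ 0) (ho : o ∣ n * p ^ b)
    (hno : n ∣ o * p ^ b) (hlt : o < n) : p ∣ n ∧ o ∣ n / p := by
  obtain ⟨a, n', hn', rfl⟩ := Nat.exists_eq_pow_mul_and_not_dvd hn p hp.ne_one
  have hcop : Nat.Coprime n' p := ((Nat.Prime.coprime_iff_not_dvd hp).2 hn').symm
  have h1 : n' ∣ o := (hcop.pow_right b).dvd_of_dvd_mul_right ((Dvd.intro_left _ rfl).trans hno)
  obtain ⟨o', rfl⟩ := h1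
  have hn0 : 0 < n' := Nat.pos_of_ne_zero fun h => hn (by rw [h, mul_zero])
  have h2 : o' ∣ p ^ (a + b) := by
    refine Nat.dvd_of_mul_dvd_mul_left hn0 (ho.trans (dvd_of_eq ?_))
    rw [pow_add]; ring
  obtain ⟨c, -, rfl⟩ := (Nat.dvd_prime_pow hp).1 h2
  have h3 : c < a := by
    rw [mul_comm] at hlt
    exact (Nat.pow_lt_pow_iff_right hp.one_lt).1 (Nat.lt_of_mul_lt_mul_right hlt)
  obtain ⟨a, rfl⟩ : ∃ a', a = a' + 1 := ⟨a - 1, by omega⟩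
  have e : p ^ (a + 1) * n' = p * (p ^ a * n') := by rw [pow_succ]; ring
  rw [e, Nat.mul_div_cancel_left _ hp.pos]
  exact ⟨dvd_mul_right _ _, by
    rw [mul_comm]; exact Nat.mul_dvd_mul_right (pow_dvd_pow p (by omega)) _⟩

/-- If all elements `d + F j` have order at most that of `d`, only few of them have the same order
as `d`, and `F` is a polynomial function with `F 0 = 0`, then the values of `F` have bounded
order. -/
theorem polyExp_smul_eq_zero_of_addOrderOf_le {m q : ℕ} {F : ℕ → A}
    (h : (fwdDiff 1)^[q + 1] F = 0) (h0 : F 0 = 0) (d : A)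
    (hmax : ∀ j, addOrderOf d = 0 ∨
      (addOrderOf (d + F j) ≠ 0 ∧ addOrderOf (d + F j) ≤ addOrderOf d))
    (V : Finset A) (hV : V.card ≤ m)
    (hG : ∀ j, addOrderOf (d + F j) = addOrderOf d → F j ∈ V) (j : ℕ) :
    polyExp m q • F j = 0 := by
  -- `K • (d + G)` obeys the same degree bound, so zeros at `q + 1` consecutive arguments make it
  -- vanish everywhere, in particular at `0`, where it is `K • d`.
  have hK : ∀ (K : ℕ) (G : ℕ → A) (_ : (fwdDiff 1)^[q + 1] G = 0) (_ : G 0 = 0) (i : ℕ)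
      (_ : ∀ t ≤ q, K • (d + G (i + t)) = 0), K • d = 0 := by
    intro K G hG hG0 i hi
    have e : (fwdDiff 1)^[q + 1] (K • ((fun _ => d) + G)) = 0 := by
      rw [fwdDiff_iter_const_smul, fwdDiff_iter_add, hG, add_zero, Function.iterate_succ_apply,
        fwdDiff_const]
      have : ∀ k, (fwdDiff 1)^[k] (fun _ : ℕ => (0 : A)) = 0 := by
        intro k
        induction k with
        | zero => rfl
        | succ k ih => rw [Function.iterate_succ_apply, fwdDiff_const]; exact ih
      rw [this, smul_zero]
    have := eq_zero_of_consecutive_zeros e hi 0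
    simpa [hG0] using this
  -- The value `0` encodes infinite order. A window of elements of finite order would let the
  -- product of their orders kill `d`.
  by_cases hd : addOrderOf d = 0
  · refine polyExp_smul_eq_zero h h0 (fun j => addOrderOf (d + F j) = addOrderOf d) ?_ V hV hG j
    intro i
    by_contra! hcon
    rw [hd] at hcon
    have hne : ∏ t ∈ range (q + 1), addOrderOf (d + F (i + t)) ≠ 0 :=
      Finset.prod_ne_zero_iff.2 fun t ht => hcon t (Nat.lt_succ_iff.1 (Finset.mem_range.1 ht))
    have := hK (∏ t ∈ range (q + 1), addOrderOf (d + F (i + t))) F h h0 i fun t ht =>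
      addOrderOf_dvd_iff_nsmul_eq_zero.1
        (Finset.dvd_prod_of_mem _ (Finset.mem_range.2 (Nat.lt_succ_of_le ht)))
    have := addOrderOf_dvd_iff_nsmul_eq_zero.2 this
    rw [hd] at this
    exact hne (zero_dvd_iff.1 this)
  replace hmax := fun j => (hmax j).resolve_left hd
  set n := addOrderOf d with hn
  have hfac : ∀ i, n.factorial • F i = 0 := by
    intro i
    have h1 : n.factorial • (d + F i) = 0 := addOrderOf_dvd_iff_nsmul_eq_zero.1
      (Nat.dvd_factorial (Nat.pos_of_ne_zero (hmax i).1) (hmax i).2)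
    have h2 : n.factorial • d = 0 := addOrderOf_dvd_iff_nsmul_eq_zero.1
      (Nat.dvd_factorial (Nat.pos_of_ne_zero hd) le_rfl)
    rwa [smul_add, h2, zero_add] at h1
  by_contra hne
  obtain ⟨p, hp, hpdvd⟩ := Nat.exists_prime_and_dvd
    (fun h1 => hne (AddMonoid.addOrderOf_eq_one_iff.1 h1))
  obtain ⟨b, s, hs, hbs⟩ := Nat.exists_eq_pow_mul_and_not_dvd (Nat.factorial_ne_zero n) p hp.ne_one
  have hcop : Nat.Coprime (p ^ b) s := ((Nat.Prime.coprime_iff_not_dvd hp).2 hs).pow_left b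
  -- Dilation by `u` isolates the `p`-part: `F (u * i)` is killed by `p ^ b` and agrees with `F i`
  -- after multiplication by `s`. For the dilated sequence an order below `n` divides `n / p`, so a
  -- whole window of such orders would give `(n / p) • d = 0`.
  obtain ⟨u, hu1, hu2⟩ := Nat.chineseRemainder ((hcop.pow_left q).pow_right q) 1 0
  have hsF : ∀ i, s • F (u * i) = s • F i := by
    intro i
    refine eq_of_modEq (F := s • F) (s := p ^ b) (q := q) ?_ (fun j => ?_) ?_
    · rw [fwdDiff_iter_const_smul, h, smul_zero]
    · rw [Pi.smul_apply, smul_smul, ← hbs, hfac]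
    · simpa using hu1.mul_right i
  have hpF : ∀ i, p ^ b • F (u * i) = 0 := by
    intro i
    have := eq_of_modEq (F := p ^ b • F) (s := s) (q := q) (i := u * i) (j := 0) ?_ (fun j => ?_) ?_
    · simpa [h0] using this
    · rw [fwdDiff_iter_const_smul, h, smul_zero]
    · rw [Pi.smul_apply, smul_smul, mul_comm, ← hbs, hfac]
    · simpa using hu2.mul_right i
  have key := polyExp_smul_eq_zero (fwdDiff_iter_dilate h u) (by simpa using h0)
    (fun j => addOrderOf (d + F (u * j)) = n) ?_ V hV (fun j hj => hG _ hj) j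
  · refine hs (hpdvd.trans (addOrderOf_dvd_iff_nsmul_eq_zero.2 ?_))
    rw [smul_comm, ← hsF, smul_comm, key, smul_zero]
  intro i
  by_contra! hcon
  have hbad : ∀ t ≤ q, p ∣ n ∧ addOrderOf (d + F (u * (i + t))) ∣ n / p := by
    intro t ht
    refine dvd_div_of_lt (b := b) hp hd ?_ ?_ (lt_of_le_of_ne (hmax _).2 (hcon t ht))
    · refine addOrderOf_dvd_iff_nsmul_eq_zero.2 ?_
      rw [smul_add, mul_smul, mul_smul, hpF, smul_zero, add_zero, smul_comm, hn,
        addOrderOf_nsmul_eq_zero, smul_zero]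
    · refine addOrderOf_dvd_iff_nsmul_eq_zero.2 ?_
      have : p ^ b • d = p ^ b • (d + F (u * (i + t))) := by rw [smul_add, hpF, add_zero]
      rw [mul_smul, this, smul_comm, addOrderOf_nsmul_eq_zero, smul_zero]
  have := hK (n / p) _ (fwdDiff_iter_dilate h u) (by simpa using h0) i
    fun t ht => addOrderOf_dvd_iff_nsmul_eq_zero.1 (hbad t ht).2
  have h1 := addOrderOf_dvd_iff_nsmul_eq_zero.2 this
  have h2 : 0 < n / p := Nat.div_pos (Nat.le_of_dvd (Nat.pos_of_ne_zero hd) (hbad 0 (by omega)).1) hp.pos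
  exact absurd (Nat.le_of_dvd h2 h1) (not_le.2 (Nat.div_lt_self (Nat.pos_of_ne_zero hd) hp.one_lt))

end Abelian

/-! ### Polynomial sequences in nilpotent groups. -/

section PolynomialSequences

open scoped commutatorElement

variable {G : Type*} [Group G]

theorem mul_comm_eq_conj (g h : G) : g * comm g h = h⁻¹ * g * h := by
  simp only [comm]; group

/-- The multiplicative difference of a sequence. -/
def seqDiff (s : ℕ → G) : ℕ → G := fun j => (s j)⁻¹ * s (j + 1)

/-- `PolySeq Γ k a s`: the `i`-th difference of `s` takes values in `Γ (a + i)` for `i ≤ k`. -/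
def PolySeq (Γ : ℕ → Subgroup G) : ℕ → ℕ → (ℕ → G) → Prop
  | 0, a, s => ∀ j, s j ∈ Γ a
  | k + 1, a, s => (∀ j, s j ∈ Γ a) ∧ PolySeq Γ k (a + 1) (seqDiff s)

variable {Γ : ℕ → Subgroup G}

theorem PolySeq.of_succ {k a : ℕ} {s : ℕ → G} (h : PolySeq Γ (k + 1) a s) : PolySeq Γ k a s := by
  induction k generalizing a s with
  | zero => exact h.1
  | succ k ih => exact ⟨h.1, ih h.2⟩

theorem PolySeq.anti (hΓ : Antitone Γ) {k a b : ℕ} (hab : b ≤ a) {s : ℕ → G}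
    (h : PolySeq Γ k a s) : PolySeq Γ k b s := by
  induction k generalizing a b s with
  | zero => exact fun j => hΓ hab (h j)
  | succ k ih => exact ⟨fun j => hΓ hab (h.1 j), ih (Nat.succ_le_succ hab) h.2⟩

theorem seqDiff_mul (s t : ℕ → G) :
    seqDiff (s * t) = seqDiff s * comm (seqDiff s) t * seqDiff t := by
  funext j
  simp only [seqDiff, comm, Pi.mul_apply, Pi.inv_apply]
  group

theorem seqDiff_inv (s : ℕ → G) :
    seqDiff s⁻¹ = (seqDiff s)⁻¹ * comm (seqDiff s)⁻¹ s⁻¹ := by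
  funext j
  simp only [seqDiff, comm, Pi.mul_apply, Pi.inv_apply]
  group

/-- Every factor on the right involves a difference of `s` or `t`, hence lies one level deeper in
the filtration. -/
theorem seqDiff_comm (s t : ℕ → G) :
    seqDiff (comm s t) =
      (comm s (seqDiff t) * comm (comm s (seqDiff t)) (seqDiff s) * comm (seqDiff s) (seqDiff t)) *
      comm (comm s (seqDiff t) * comm (comm s (seqDiff t)) (seqDiff s) *
        comm (seqDiff s) (seqDiff t)) (comm s t) *
      comm (comm s t) (seqDiff s * seqDiff t) *
      (comm (seqDiff s) t * comm (comm (seqDiff s) t) (seqDiff t)) := by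
  simp only [mul_comm_eq_conj]
  funext j
  simp only [seqDiff, comm, Pi.mul_apply, Pi.inv_apply]
  group

/-- The Lazard–Leibman theorem: polynomial sequences in a filtered group form a filtered group. -/
theorem PolySeq.mul_inv_comm (hΓ : Antitone Γ)
    (hc : ∀ a b, ∀ g ∈ Γ a, ∀ h ∈ Γ b, comm g h ∈ Γ (a + b)) (k : ℕ) :
    (∀ a s t, PolySeq Γ k a s → PolySeq Γ k a t → PolySeq Γ k a (s * t)) ∧
    (∀ a s, PolySeq Γ k a s → PolySeq Γ k a s⁻¹) ∧
    (∀ a b s t, PolySeq Γ k a s → PolySeq Γ k b t → PolySeq Γ k (a + b) (comm s t)) := by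
  -- Truncation at `k` differences is what lets the three closure properties be proved
  -- simultaneously: the difference formulas use them only at depth `k`.
  induction k with
  | zero =>
    exact ⟨fun a s t hs ht j => mul_mem (hs j) (ht j), fun a s hs j => inv_mem (hs j),
      fun a b s t hs ht j => hc a b _ (hs j) _ (ht j)⟩
  | succ k ih =>
    obtain ⟨hm, hi, hcm⟩ := ih
    refine ⟨fun a s t hs ht => ⟨fun j => mul_mem (hs.1 j) (ht.1 j), ?_⟩,
      fun a s hs => ⟨fun j => inv_mem (hs.1 j), ?_⟩,
      fun a b s t hs ht => ⟨fun j => hc a b _ (hs.1 j) _ (ht.1 j), ?_⟩⟩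
    · rw [seqDiff_mul]
      exact hm _ _ _ (hm _ _ _ hs.2 ((hcm _ _ _ _ hs.2 ht.of_succ).anti hΓ (by omega))) ht.2
    · rw [seqDiff_inv]
      exact hm _ _ _ (hi _ _ hs.2)
        ((hcm _ _ _ _ (hi _ _ hs.2) (hi _ _ hs.of_succ)).anti hΓ (by omega))
    · rw [seqDiff_comm]
      have h1 : PolySeq Γ k (a + b + 1) (comm s (seqDiff t)) :=
        (hcm _ _ _ _ hs.of_succ ht.2).anti hΓ (by omega)
      have h2 : PolySeq Γ k (a + b + 1) (comm (seqDiff s) t) :=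
        (hcm _ _ _ _ hs.2 ht.of_succ).anti hΓ (by omega)
      have hX : PolySeq Γ k (a + b + 1) (comm s (seqDiff t) *
          comm (comm s (seqDiff t)) (seqDiff s) * comm (seqDiff s) (seqDiff t)) :=
        hm _ _ _ (hm _ _ _ h1 ((hcm _ _ _ _ h1 hs.2).anti hΓ (by omega)))
          ((hcm _ _ _ _ hs.2 ht.2).anti hΓ (by omega))
      have hcc := hcm _ _ _ _ hs.of_succ ht.of_succ
      have hαβ : PolySeq Γ k 1 (seqDiff s * seqDiff t) :=
        hm _ _ _ (hs.2.anti hΓ (by omega)) (ht.2.anti hΓ (by omega))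
      exact hm _ _ _ (hm _ _ _ (hm _ _ _ hX ((hcm _ _ _ _ hX hcc).anti hΓ (by omega)))
        (hcm _ _ _ _ hcc hαβ)) (hm _ _ _ h2 ((hcm _ _ _ _ h2 ht.2).anti hΓ (by omega)))

theorem PolySeq.conj (z : G) (hz : ∀ a, ∀ g ∈ Γ a, z⁻¹ * g * z ∈ Γ a) {k a : ℕ} {s : ℕ → G}
    (h : PolySeq Γ k a s) : PolySeq Γ k a fun j => z⁻¹ * s j * z := by
  induction k generalizing a s with
  | zero => exact fun j => hz _ _ (h j)
  | succ k ih =>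
    refine ⟨fun j => hz _ _ (h.1 j), ?_⟩
    convert! ih h.2 using 1
    funext j
    simp only [seqDiff]
    group

theorem PolySeq.iterate_mem {k a : ℕ} {s : ℕ → G} (h : PolySeq Γ k a s) (j : ℕ) :
    seqDiff^[k] s j ∈ Γ (a + k) := by
  induction k generalizing a s with
  | zero => exact h j
  | succ k ih =>
    have := ih h.2
    rwa [add_right_comm] at this

theorem polySeq_of_iterate_mem {k a : ℕ} {s : ℕ → G}
    (h : ∀ i j, seqDiff^[i] s j ∈ Γ (a + i)) : PolySeq Γ k a s := by
  induction k generalizing a s with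
  | zero => exact h 0
  | succ k ih =>
    refine ⟨h 0, ih fun i j => ?_⟩
    have := h (i + 1) j
    rwa [add_assoc, add_comm 1 i]

/-- The three subgroups lemma in `G ⧸ W`. -/
theorem commutator_commutator_le_of_rotate (H₁ H₂ H₃ W : Subgroup G) [W.Normal]
    (h1 : ⁅⁅H₂, H₃⁆, H₁⁆ ≤ W) (h2 : ⁅⁅H₃, H₁⁆, H₂⁆ ≤ W) : ⁅⁅H₁, H₂⁆, H₃⁆ ≤ W := by
  have key : ∀ X : Subgroup G, X ≤ W ↔ X.map (QuotientGroup.mk' W) = ⊥ := by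
    intro X
    rw [Subgroup.map_eq_bot_iff, QuotientGroup.ker_mk']
  rw [key, Subgroup.map_commutator, Subgroup.map_commutator] at *
  exact Subgroup.commutator_commutator_eq_bot_of_rotate h1 h2

theorem commutator_top_lowerCentralSeries_le (a b : ℕ) :
    ⁅(⊤ : Subgroup G).lowerCentralSeries a, (⊤ : Subgroup G).lowerCentralSeries b⁆ ≤
      (⊤ : Subgroup G).lowerCentralSeries (a + b + 1) := by
  induction b generalizing a with
  | zero => exact le_rfl
  | succ b ih =>
    rw [Subgroup.commutator_comm, Subgroup.lowerCentralSeries_succ _ b]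
    refine commutator_commutator_le_of_rotate _ _ _ _ ?_ ?_
    · rw [Subgroup.commutator_comm ⊤, ← Subgroup.lowerCentralSeries_succ]
      exact (ih (a + 1)).trans (le_of_eq (congrArg _ (by omega)))
    · rw [← add_assoc, Subgroup.lowerCentralSeries_succ _ (a + b + 1)]
      exact Subgroup.commutator_mono (ih a) le_rfl

theorem comm_eq_commutatorElement (g h : G) : comm g h = ⁅g⁻¹, h⁻¹⁆ := by
  simp [comm, commutatorElement_def]

theorem comm_mem_lowerCentralSeries (K : Subgroup G) {a b : ℕ} {g h : G}
    (hg : g ∈ K.lowerCentralSeries a) (hh : h ∈ K.lowerCentralSeries b) :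
    comm g h ∈ K.lowerCentralSeries (a + b + 1) := by
  rw [comm_eq_commutatorElement]
  rw [← Subgroup.top_subtype_lowerCentralSeries] at hg hh ⊢
  refine (Subgroup.map_mono (commutator_top_lowerCentralSeries_le a b)) ?_
  rw [Subgroup.map_commutator]
  exact Subgroup.commutator_mem_commutator (inv_mem hg) (inv_mem hh)

/-- In a nilpotent subgroup `K` of class at most `c`, the sequences with vanishing
`(q + 1)`-st difference lie in a group of sequences with vanishing `(q * c + 1)`-st difference. -/
theorem exists_polySeq_subgroup (K : Subgroup G) {c q : ℕ} (hK : K.lowerCentralSeries c = ⊥)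
    (hq : 0 < q) : ∃ S : Subgroup (ℕ → G),
      (∀ s, (∀ j, s j ∈ K) → seqDiff^[q + 1] s = 1 → s ∈ S) ∧
      (K.Normal → ∀ (z : G), ∀ s ∈ S, (fun j => z⁻¹ * s j * z) ∈ S) ∧
      ∀ s ∈ S, seqDiff^[q * c + 1] s = 1 := by
  -- Here `Γ 0 = … = Γ q = K`, and each later term of the lower central series is repeated `q`
  -- times. So the first `q` differences are only required to lie in `K`, while the one of index `q
  -- * c + 1` is trivial.
  set Γ : ℕ → Subgroup G := fun i => K.lowerCentralSeries ((i - 1) / q) with hΓ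
  have hanti : Antitone Γ := fun a b hab =>
    K.lowerCentralSeries_antitone (Nat.div_le_div_right (Nat.sub_le_sub_right hab 1))
  have hcomm : ∀ a b, ∀ g ∈ Γ a, ∀ h ∈ Γ b, comm g h ∈ Γ (a + b) := by
    intro a b g hg h hh
    refine K.lowerCentralSeries_antitone ?_ (comm_mem_lowerCentralSeries K hg hh)
    rcases Nat.eq_zero_or_pos a with rfl | ha
    · simp
    rcases Nat.eq_zero_or_pos b with rfl | hb
    · simp
    have h1 := Nat.lt_mul_div_succ (a - 1) hq
    have h2 := Nat.lt_mul_div_succ (b - 1) hq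
    refine Nat.lt_succ_iff.1 ((Nat.div_lt_iff_lt_mul hq).2 ?_)
    calc a + b - 1 < q * ((a - 1) / q + 1) + q * ((b - 1) / q + 1) := by omega
      _ = ((a - 1) / q + (b - 1) / q + 1).succ * q := by rw [Nat.succ_eq_add_one]; ring
  have main := PolySeq.mul_inv_comm hanti hcomm
  refine ⟨{ carrier := {s | ∀ k, PolySeq Γ k 0 s}
            mul_mem' := fun hs ht k => (main k).1 _ _ _ (hs k) (ht k)
            one_mem' := fun k => polySeq_of_iterate_mem fun i j => ?_
            inv_mem' := fun hs k => (main k).2.1 _ _ (hs k) }, ?_, ?_, ?_⟩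
  · have : ∀ i, seqDiff^[i] (1 : ℕ → G) = 1 := by
      intro i
      induction i with
      | zero => rfl
      | succ i ih =>
        rw [Function.iterate_succ_apply]
        convert! ih
        funext j; simp [seqDiff]
    rw [this]
    exact one_mem _
  · intro s hs hv k
    refine polySeq_of_iterate_mem fun i j => ?_
    rw [zero_add]
    have hmem : ∀ i j, seqDiff^[i] s j ∈ K := by
      intro i
      induction i with
      | zero => exact hs
      | succ i ih =>
        intro j
        rw [Function.iterate_succ_apply']
        exact mul_mem (inv_mem (ih j)) (ih (j + 1))
    rcases Nat.lt_or_ge q i with hi | hi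
    · obtain ⟨t, rfl⟩ := Nat.exists_eq_add_of_lt hi
      have : seqDiff^[q + t + 1] s = 1 := by
        clear hi
        induction t with
        | zero => exact hv
        | succ t ih =>
          rw [← add_assoc, Function.iterate_succ_apply', ih]
          funext j; simp [seqDiff]
      rw [this]
      exact one_mem _
    · have : (i - 1) / q = 0 := Nat.div_eq_of_lt (by omega)
      simp only [hΓ, this]
      exact hmem i j
  · intro hN z s hs k
    refine (hs k).conj z fun a g hg => ?_
    have : (Γ a).Normal := Subgroup.lowerCentralSeries_normal K _
    simpa using this.conj_mem g hg z⁻¹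
  · intro s hs
    funext j
    have := (hs (q * c + 1)).iterate_mem j
    simp only [hΓ, zero_add, Nat.add_sub_cancel, Nat.mul_div_cancel_left _ hq, hK] at this
    exact this

end PolynomialSequences

/-! ### Commutator tails and the verbal subgroups that kill them. -/

section Tails

variable {G : Type*} [Group G]

theorem comm_mul_left (g h z : G) : comm (g * h) z = h⁻¹ * comm g z * h * comm h z := by
  simp only [comm]; group

theorem comm_mul_right (g x n : G) : comm g (x * n) = comm g n * (n⁻¹ * comm g x * n) := by
  simp only [comm]; group

theorem comm_conj_left (g z n : G) :
    comm (n⁻¹ * g * n) z = n⁻¹ * comm g (n * z * n⁻¹) * n := by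
  simp only [comm]; group

theorem comm_mem_right {N : Subgroup G} (hN : N.Normal) (g : G) {n : G} (hn : n ∈ N) :
    comm g n ∈ N := by
  have := N.mul_mem (hN.conj_mem _ (inv_mem hn) g⁻¹) hn
  simpa [comm] using this

theorem comm_mem_left {N : Subgroup G} (hN : N.Normal) {n : G} (hn : n ∈ N) (g : G) :
    comm n g ∈ N := by
  have := N.mul_mem (inv_mem hn) (hN.conj_mem _ hn g⁻¹)
  simpa [comm, mul_assoc] using this

theorem conj_mem_of_normal {N : Subgroup G} (hN : N.Normal) {n : G} (hn : n ∈ N) (g : G) :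
    g⁻¹ * n * g ∈ N := by
  simpa using hN.conj_mem n hn g⁻¹

/-- `Tail N E [x₁, …, x_k] g`: all commutators `[g, z₁, …, z_k]` with `z_i ∈ {x_i} ∪ N` lie in `E`,
and `g ∈ N` when `k > 0`. -/
def Tail (N E : Subgroup G) : List G → G → Prop
  | [], g => g ∈ E
  | x :: L, g => g ∈ N ∧ Tail N E L (comm g x) ∧ ∀ n ∈ N, Tail N E L (comm g n)

variable {N E : Subgroup G}

theorem Tail.mem (hE : E ≤ N) {L : List G} {g : G} (h : Tail N E L g) : g ∈ N := by
  cases L with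
  | nil => exact hE h
  | cons x L => exact h.1

/-- The claims depend on each other: `[gh, z] = [g, z]^h [h, z]` uses invariance under conjugation,
and conjugation by `n` turns the entry `x` into an element of `xN`, which is expanded by products.
-/
theorem Tail.closure_props (hN : N.Normal) (hEN : ∀ g ∈ E, ∀ n ∈ N, n⁻¹ * g * n ∈ E)
    (L : List G) :
    Tail N E L 1 ∧ (∀ g h, Tail N E L g → Tail N E L h → Tail N E L (g * h)) ∧
    (∀ g, Tail N E L g → Tail N E L g⁻¹) ∧
    (∀ g, Tail N E L g → ∀ n ∈ N, Tail N E L (n⁻¹ * g * n)) := by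
  induction L with
  | nil =>
    exact ⟨one_mem E, fun g h => E.mul_mem, fun g => E.inv_mem, hEN⟩
  | cons x L ih =>
    obtain ⟨h1, hm, hi, hc⟩ := ih
    have e1 : ∀ z : G, comm 1 z = 1 := fun z => by simp [comm]
    refine ⟨⟨one_mem N, by rw [e1]; exact h1, fun n _ => by rw [e1]; exact h1⟩,
      fun g h hg hh => ⟨N.mul_mem hg.1 hh.1, ?_, fun n hn => ?_⟩,
      fun g hg => ⟨N.inv_mem hg.1, ?_, fun n hn => ?_⟩,
      fun g hg n hn => ⟨conj_mem_of_normal hN hg.1 n, ?_, fun n' hn' => ?_⟩⟩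
    · rw [comm_mul_left]
      exact hm _ _ (hc _ hg.2.1 _ hh.1) hh.2.1
    · rw [comm_mul_left]
      exact hm _ _ (hc _ (hg.2.2 n hn) _ hh.1) (hh.2.2 n hn)
    · have : comm g⁻¹ x = (g⁻¹)⁻¹ * (comm g x)⁻¹ * g⁻¹ := by simp only [comm]; group
      rw [this]
      exact hc _ (hi _ hg.2.1) _ (inv_mem hg.1)
    · have : comm g⁻¹ n = (g⁻¹)⁻¹ * (comm g n)⁻¹ * g⁻¹ := by simp only [comm]; group
      rw [this]
      exact hc _ (hi _ (hg.2.2 n hn)) _ (inv_mem hg.1)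
    · have e : n * x * n⁻¹ = x * (x⁻¹ * n * x * n⁻¹) := by group
      have hn' : x⁻¹ * n * x * n⁻¹ ∈ N := N.mul_mem (conj_mem_of_normal hN hn x) (inv_mem hn)
      rw [comm_conj_left, e, comm_mul_right]
      exact hc _ (hm _ _ (hg.2.2 _ hn') (hc _ hg.2.1 _ hn')) _ hn
    · rw [comm_conj_left]
      exact hc _ (hg.2.2 _ (hN.conj_mem _ hn' n)) _ hn

/-- The subgroup of all `g` with `Tail N E L g`. -/
def tailSubgroup (hN : N.Normal) (hEN : ∀ g ∈ E, ∀ n ∈ N, n⁻¹ * g * n ∈ E) (L : List G) :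
    Subgroup G where
  carrier := {g | Tail N E L g}
  one_mem' := (Tail.closure_props hN hEN L).1
  mul_mem' := (Tail.closure_props hN hEN L).2.1 _ _
  inv_mem' := (Tail.closure_props hN hEN L).2.2.1 _

theorem Tail.conj (hN : N.Normal) (hEN : ∀ g ∈ E, ∀ n ∈ N, n⁻¹ * g * n ∈ E) {L : List G} {g : G}
    (h : Tail N E L g) {n : G} (hn : n ∈ N) : Tail N E L (n⁻¹ * g * n) :=
  (Tail.closure_props hN hEN L).2.2.2 g h n hn

theorem Tail.comm_coset (hN : N.Normal) (hEN : ∀ g ∈ E, ∀ n ∈ N, n⁻¹ * g * n ∈ E) {x z : G}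
    {L : List G} {g : G} (h : Tail N E (x :: L) g) (hz : x⁻¹ * z ∈ N) :
    Tail N E L (comm g z) := by
  have e : z = x * (x⁻¹ * z) := by group
  rw [e, comm_mul_right]
  exact (tailSubgroup hN hEN L).mul_mem (h.2.2 _ hz) (h.2.1.conj hN hEN hz)

theorem Tail.foldl_mem {L W : List G} {g : G} (h : Tail N E L g)
    (hW : List.Forall₂ (fun x w => w = x ∨ w ∈ N) L W) : W.foldl comm g ∈ E := by
  induction hW generalizing g with
  | nil => exact h
  | cons hw _ ih =>
    rcases hw with rfl | hw
    · exact ih h.2.1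
    · exact ih (h.2.2 _ hw)

/-- `[g, n]` is recovered from `[g, xn]` and `[g, x]`. Stability supplies information only about
entries in the cosets `x_i N`. -/
theorem tail_of_cosets (hN : N.Normal) (hEN : ∀ g ∈ E, ∀ n ∈ N, n⁻¹ * g * n ∈ E) {L : List G}
    {g : G} (hg : g ∈ N)
    (h : ∀ zs, List.Forall₂ (fun x z => x⁻¹ * z ∈ N) L zs → zs.foldl comm g ∈ E) :
    Tail N E L g := by
  induction L generalizing g with
  | nil => exact h [] List.Forall₂.nil
  | cons x L ih =>
    have key : ∀ z, x⁻¹ * z ∈ N → Tail N E L (comm g z) := fun z hz =>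
      ih (comm_mem_left hN hg z) fun zs hzs => h (z :: zs) (List.Forall₂.cons hz hzs)
    refine ⟨hg, key x (by simp), fun n hn => ?_⟩
    have e : comm g n = comm g (x * n) * (n⁻¹ * comm g (x * 1) * n)⁻¹ := by
      rw [mul_one, comm_mul_right]; group
    rw [e]
    exact (tailSubgroup hN hEN L).mul_mem (key _ (by simpa using hn))
      ((tailSubgroup hN hEN L).inv_mem ((key _ (by simp)).conj hN hEN hn))

theorem Tail.restrict {N' : Subgroup G} (hN' : N'.Normal) (hle : N' ≤ N) {L : List G} {g : G}
    (h : Tail N E L g) (hg : g ∈ N') : Tail N' E L g := by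
  induction L generalizing g with
  | nil => exact h
  | cons x L ih =>
    exact ⟨hg, ih h.2.1 (comm_mem_left hN' hg x),
      fun n hn => ih (h.2.2 n (hle hn)) (comm_mem_left hN' hg n)⟩

theorem bot_conj_mem (N : Subgroup G) :
    ∀ g ∈ (⊥ : Subgroup G), ∀ n ∈ N, n⁻¹ * g * n ∈ (⊥ : Subgroup G) := by
  rintro g hg n -
  rw [Subgroup.mem_bot] at hg ⊢
  simp [hg]

/-- The subgroup generated by the `e`-th powers and the commutators of elements of `N`. -/
def verb (e : ℕ) (N : Subgroup G) : Subgroup G :=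
  Subgroup.closure ({g | ∃ n ∈ N, g = n ^ e} ∪ {g | ∃ n ∈ N, ∃ n' ∈ N, g = comm n n'})

theorem verb_le (e : ℕ) (N : Subgroup G) : verb e N ≤ N := by
  rw [verb, Subgroup.closure_le]
  rintro g (⟨n, hn, rfl⟩ | ⟨n, hn, n', hn', rfl⟩)
  · exact N.pow_mem hn e
  · exact N.mul_mem (N.mul_mem (N.mul_mem (N.inv_mem hn) (N.inv_mem hn')) hn) hn'

theorem verb_normal (e : ℕ) (hN : N.Normal) : (verb e N).Normal := by
  refine ⟨fun g hg z => ?_⟩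
  have : (verb e N) ≤ (verb e N).comap (MulAut.conj z).toMonoidHom := by
    conv_lhs => rw [verb]
    rw [Subgroup.closure_le]
    rintro g (⟨n, hn, rfl⟩ | ⟨n, hn, n', hn', rfl⟩)
    · refine Subgroup.subset_closure (Or.inl ⟨_, hN.conj_mem n hn z, ?_⟩)
      simp
    · refine Subgroup.subset_closure (Or.inr ⟨_, hN.conj_mem n hn z, _, hN.conj_mem n' hn' z, ?_⟩)
      simp only [MulEquiv.toMonoidHom_eq_coe, MonoidHom.coe_coe, MulAut.conj_apply, comm]
      group
  exact this hg

/-- A map that is a homomorphism from `N` to an abelian group of exponent dividing `e` is trivial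
on `verb e N`. -/
theorem mem_of_mem_verb {e : ℕ} {N R S : Subgroup G} (ψ : G → G) (hψ : ∀ n ∈ N, ψ n ∈ R)
    (hS : ∀ s ∈ S, ∀ g ∈ R, g⁻¹ * s * g ∈ S) (hpow : ∀ g ∈ R, g ^ e ∈ S)
    (hcomm : ∀ g ∈ R, ∀ h ∈ R, comm g h ∈ S)
    (hmul : ∀ n ∈ N, ∀ n' ∈ N, (ψ n * ψ n')⁻¹ * ψ (n * n') ∈ S) {n : G} (hn : n ∈ verb e N) :
    ψ n ∈ S := by
  have hnormal : (S.subgroupOf R).Normal := ⟨fun s hs g => by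
    rw [Subgroup.mem_subgroupOf] at hs ⊢
    simpa using hS s hs (g⁻¹ : R) (g⁻¹ : R).2⟩
  let f : N →* R ⧸ S.subgroupOf R := MonoidHom.mk' (fun n => QuotientGroup.mk ⟨ψ n, hψ n n.2⟩) (by
    intro a b
    refine (QuotientGroup.eq.2 ?_).symm
    rw [Subgroup.mem_subgroupOf]
    exact hmul a a.2 b b.2)
  have hfa : ∀ n (hn : n ∈ N), f ⟨n, hn⟩ = QuotientGroup.mk ⟨ψ n, hψ n hn⟩ := fun _ _ => rfl
  have hf : ∀ n : N, f n = 1 ↔ ψ n ∈ S := fun n => by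
    rw [hfa n n.2, QuotientGroup.eq_one_iff, Subgroup.mem_subgroupOf]
  have hle : verb e N ≤ f.ker.map N.subtype := by
    rw [verb, Subgroup.closure_le]
    rintro g (⟨n, hn, rfl⟩ | ⟨n, hn, n', hn', rfl⟩)
    · refine ⟨⟨n, hn⟩ ^ e, ?_, rfl⟩
      rw [SetLike.mem_coe, MonoidHom.mem_ker, map_pow, hfa, ← QuotientGroup.mk_pow,
        QuotientGroup.eq_one_iff, Subgroup.mem_subgroupOf]
      exact hpow _ (hψ n hn)
    · refine ⟨comm ⟨n, hn⟩ ⟨n', hn'⟩, ?_, rfl⟩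
      rw [SetLike.mem_coe, MonoidHom.mem_ker, comm, map_mul, map_mul, map_mul, map_inv, map_inv,
        hfa, hfa, ← QuotientGroup.mk_inv, ← QuotientGroup.mk_inv,
        ← QuotientGroup.mk_mul, ← QuotientGroup.mk_mul, ← QuotientGroup.mk_mul,
        QuotientGroup.eq_one_iff, Subgroup.mem_subgroupOf]
      exact hcomm _ (hψ n hn) _ (hψ n' hn')
  obtain ⟨k, hk, rfl⟩ := hle hn
  exact (hf k).1 hk

theorem verb_iterate_normal (e : ℕ) (hN : N.Normal) (p : ℕ) : ((verb e)^[p] N).Normal := by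
  induction p with
  | zero => exact hN
  | succ p ih => rw [Function.iterate_succ_apply']; exact verb_normal e ih

theorem verb_iterate_le (e : ℕ) (N : Subgroup G) (p : ℕ) : (verb e)^[p] N ≤ N := by
  induction p with
  | zero => exact le_rfl
  | succ p ih => rw [Function.iterate_succ_apply']; exact (verb_le e _).trans ih

theorem comm_mul_right_quotient (g n n' : G) :
    (comm g n * comm g n')⁻¹ * comm g (n * n') =
      comm (comm g n') (comm g n) * comm (comm g n) n' := by
  simp only [comm]; group

theorem comm_mul_left_quotient (g h x : G) :
    (comm g x * comm h x)⁻¹ * comm (g * h) x =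
      (comm h x)⁻¹ * comm (comm g x) h * comm h x := by
  simp only [comm]; group

/-- The two claims say that elements with tails in `E`, modulo those with trivial tails, form an
abelian group of exponent dividing `e`. Then `n ↦ [g, n]` and `g ↦ [g, x]` are homomorphisms into
such a group and vanish on the next verbal subgroup, so each entry of `L` costs one application of
`verb e`. -/
theorem Tail.verb_bot (hN : N.Normal) {e : ℕ}
    (hcent : ∀ g ∈ E, ∀ n ∈ N, comm g n = 1) (hexp : ∀ g ∈ E, g ^ e = 1) (L : List G) :
    (∀ g ∈ (verb e)^[L.length] N, Tail N E L g → Tail ((verb e)^[L.length] N) ⊥ L (g ^ e)) ∧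
    (∀ g ∈ (verb e)^[L.length] N, Tail N E L g → ∀ h ∈ (verb e)^[L.length] N,
      Tail ((verb e)^[L.length] N) ⊥ L (comm g h)) := by
  have hE : ∀ g ∈ E, ∀ n ∈ N, n⁻¹ * g * n ∈ E := fun g hg n hn => by
    rw [← mul_comm_eq_conj, hcent g hg n hn, mul_one]; exact hg
  induction L with
  | nil => exact ⟨fun g _ hg => hexp g hg, fun g _ hg h hh => hcent g hg h hh⟩
  | cons x L ih =>
    rw [List.length_cons, Function.iterate_succ_apply']
    have hMn := verb_iterate_normal e hN L.length
    have hMN := verb_iterate_le e N L.length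
    set M := (verb e)^[L.length] N with hM
    obtain ⟨iha, ihb⟩ := ih
    have hM'n := verb_normal e hMn
    have hM'M := verb_le e M
    set S := tailSubgroup hMn (bot_conj_mem M) L with hSdef
    have hSconj : ∀ s ∈ S, ∀ g ∈ M, g⁻¹ * s * g ∈ S := fun s hs g hg =>
      Tail.conj hMn (bot_conj_mem M) hs hg
    set R := tailSubgroup hN hE L ⊓ M with hR
    set R₁ := tailSubgroup hN hE (x :: L) ⊓ M with hR₁
    have hSR : ∀ s ∈ S, ∀ g ∈ R, g⁻¹ * s * g ∈ S := fun s hs g hg => hSconj s hs g hg.2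
    have hRpow : ∀ g ∈ R, g ^ e ∈ S := fun g hg => iha g hg.2 hg.1
    have hRcomm' : ∀ g ∈ R, ∀ h ∈ M, comm g h ∈ S := fun g hg h hh => ihb g hg.2 hg.1 h hh
    have hRcomm : ∀ g ∈ R, ∀ h ∈ R, comm g h ∈ S := fun g hg h hh => hRcomm' g hg h hh.2
    have hn_mem : ∀ g ∈ R₁, ∀ n ∈ N, comm g n ∈ R := fun g hg n hn =>
      ⟨hg.1.2.2 n hn, comm_mem_left hMn hg.2 n⟩
    have hx_mem : ∀ g ∈ R₁, comm g x ∈ R := fun g hg =>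
      ⟨hg.1.2.1, comm_mem_left hMn hg.2 x⟩
    have hc : ∀ g ∈ R₁, ∀ n ∈ verb e M, comm g n ∈ S := by
      intro g hg n hn
      refine mem_of_mem_verb (fun n => comm g n) (fun n hn => hn_mem g hg n (hMN hn)) hSR hRpow
        hRcomm (fun n hn n' hn' => ?_) hn
      rw [comm_mul_right_quotient]
      exact S.mul_mem (hRcomm _ (hn_mem g hg n' (hMN hn')) _ (hn_mem g hg n (hMN hn)))
        (hRcomm' _ (hn_mem g hg n (hMN hn)) _ hn')
    have hpx : ∀ g ∈ R₁, comm (g ^ e) x ∈ S := by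
      intro g hg
      refine mem_of_mem_verb (N := R₁) (e := e) (fun g => comm g x) hx_mem hSR hRpow hRcomm
        (fun g hg h hh => ?_) (Subgroup.subset_closure (Or.inl ⟨g, hg, rfl⟩))
      rw [comm_mul_left_quotient]
      exact hSR _ (hRcomm' _ (hx_mem g hg) _ hh.2) _ (hx_mem h hh)
    refine ⟨fun g hg hgt => ?_, fun g hg hgt h hh => ?_⟩
    · have hgR : g ∈ R₁ := ⟨hgt, hM'M hg⟩
      have hgM' : g ^ e ∈ verb e M := (verb e M).pow_mem hg e
      exact ⟨hgM', Tail.restrict hM'n hM'M (hpx g hgR) (comm_mem_left hM'n hgM' x),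
        fun n hn => Tail.restrict hM'n hM'M (hc _ (R₁.pow_mem hgR e) n hn)
          (comm_mem_left hM'n hgM' n)⟩
    · have hgR : g ∈ R₁ := ⟨hgt, hM'M hg⟩
      have hcM' : comm g h ∈ verb e M := comm_mem_left hM'n hg h
      have hcR : comm g h ∈ R₁ := by
        refine ⟨?_, hM'M hcM'⟩
        have e1 : comm g h = g⁻¹ * (h⁻¹ * g * h) := by simp only [comm]; group
        rw [e1]
        exact (tailSubgroup hN hE (x :: L)).mul_mem
          ((tailSubgroup hN hE (x :: L)).inv_mem hgt)
          (Tail.conj hN hE hgt (hMN (hM'M hh)))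
      refine ⟨hcM', Tail.restrict hM'n hM'M ?_ (comm_mem_left hM'n hcM' x),
        fun n hn => Tail.restrict hM'n hM'M (hc _ hcR n hn) (comm_mem_left hM'n hcM' n)⟩
      -- The identity `e2` below expresses `[[g, h], x]` through `[g, x]` and this element, to which
      -- `hc` applies.
      have hn : x⁻¹ * h * x * h⁻¹ ∈ verb e M :=
        (verb e M).mul_mem (conj_mem_of_normal hM'n hh x) (inv_mem hh)
      have hnM := hM'M hn
      have hhM := hM'M hh
      have hy := hx_mem g hgR
      have e2 : comm (comm g h) x =
          (comm (comm g x) (comm g h))⁻¹ * (((comm g x)⁻¹ *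
            (h⁻¹ * comm g (x⁻¹ * h * x * h⁻¹) * h) * comm g x) * (comm (comm g x) h *
            (h⁻¹ * comm (comm g x) (x⁻¹ * h * x * h⁻¹) * h))) := by
        simp only [comm]; group
      rw [e2]
      exact S.mul_mem (S.inv_mem (hRcomm' _ hy _ hcR.2)) (S.mul_mem
        (hSconj _ (hSconj _ (hc g hgR _ hn) h hhM) _ hy.2)
        (S.mul_mem (hRcomm' _ hy _ hhM) (hSconj _ (hRcomm' _ hy _ hnM) h hhM)))

/-- If `f` maps a normal subgroup `N` to elements all of whose tails lie in a central subgroup `E`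
of exponent dividing `e`, and `f` behaves like `n ↦ [a, n]`, then `f` maps the iterated verbal
subgroup to elements with trivial tails. -/
theorem tail_bot_of_mem_verb (hN : N.Normal) {e : ℕ}
    (hcent : ∀ g ∈ E, ∀ n ∈ N, comm g n = 1) (hexp : ∀ g ∈ E, g ^ e = 1) (L : List G) (f : G → G)
    (hfN : ∀ N' : Subgroup G, N'.Normal → ∀ n ∈ N', f n ∈ N')
    (hf : ∀ n n', (f n * f n')⁻¹ * f (n * n') = 1 ∨
      (f n * f n')⁻¹ * f (n * n') = comm (f n') (f n) * comm (f n) n')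
    (hT : ∀ n ∈ N, Tail N E L (f n)) :
    ∀ n ∈ (verb e)^[L.length + 1] N, Tail ((verb e)^[L.length + 1] N) ⊥ L (f n) := by
  have hE : ∀ g ∈ E, ∀ n ∈ N, n⁻¹ * g * n ∈ E := fun g hg n hn => by
    rw [← mul_comm_eq_conj, hcent g hg n hn, mul_one]; exact hg
  obtain ⟨ha, hb⟩ := Tail.verb_bot hN hcent hexp L
  rw [Function.iterate_succ_apply']
  have hMn := verb_iterate_normal e hN L.length
  have hMN := verb_iterate_le e N L.length
  set M := (verb e)^[L.length] N with hM
  intro n hn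
  refine Tail.restrict (verb_normal e hMn) (verb_le e M) ?_ (hfN _ (verb_normal e hMn) n hn)
  set S := tailSubgroup hMn (bot_conj_mem M) L with hSdef
  -- The one additional application of `verb e` is spent on `f` itself, a homomorphism modulo `S`.
  refine mem_of_mem_verb (R := tailSubgroup hN hE L ⊓ M) (S := S) f
    (fun n hn => ⟨hT n (hMN hn), hfN _ hMn n hn⟩)
    (fun s hs g hg => Tail.conj hMn (bot_conj_mem M) hs hg.2) (fun g hg => ha g hg.2 hg.1)
    (fun g hg h hh => hb g hg.2 hg.1 h hh.2) (fun n hn n' hn' => ?_) hn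
  rcases hf n n' with h | h <;> rw [h]
  · exact S.one_mem
  · exact S.mul_mem (hb _ (hfN _ hMn n' hn') (hT n' (hMN hn')) _ (hfN _ hMn n hn))
      (hb _ (hfN _ hMn n hn) (hT n (hMN hn)) _ hn')

end Tails

/-! ### The upper central series of a subgroup. -/

section UpperCentral

open scoped commutatorElement

variable {G : Type*} [Group G]

/-- The terms of the upper central series of a subgroup, as subgroups of the ambient group. -/
def relCenter (N : Subgroup G) (c : ℕ) : Subgroup G :=
  (Subgroup.upperCentralSeries N c).map N.subtype

theorem relCenter_zero (N : Subgroup G) : relCenter N 0 = ⊥ := by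
  simp [relCenter]

theorem relCenter_le (N : Subgroup G) (c : ℕ) : relCenter N c ≤ N := by
  rintro _ ⟨g, -, rfl⟩
  exact g.2

theorem relCenter_normal {N : Subgroup G} (hN : N.Normal) (c : ℕ) : (relCenter N c).Normal :=
  ConjAct.normal_of_characteristic_of_normal

theorem mem_relCenter_succ {N : Subgroup G} {c : ℕ} {g : G} :
    g ∈ relCenter N (c + 1) ↔ g ∈ N ∧ ∀ n ∈ N, comm g n ∈ relCenter N c := by
  constructor
  · rintro ⟨g, hg, rfl⟩
    refine ⟨g.2, fun n hn => ?_⟩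
    refine ⟨_, Subgroup.mem_upperCentralSeries_succ_iff.1 (inv_mem hg) ⟨n, hn⟩⁻¹, ?_⟩
    simp [comm_eq_commutatorElement, commutatorElement_def]
  · rintro ⟨hg, h⟩
    rw [← inv_mem_iff]
    refine ⟨⟨g, hg⟩⁻¹, Subgroup.mem_upperCentralSeries_succ_iff.2 fun y => ?_, rfl⟩
    obtain ⟨k, hk, hk'⟩ := h _ (inv_mem y.2)
    convert! hk using 1
    apply Subtype.ext
    rw [Subgroup.subtype_apply] at hk'
    rw [hk', comm_eq_commutatorElement]
    simp [commutatorElement_def]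

theorem commutator_relCenter_le (N : Subgroup G) (c : ℕ) :
    ⁅relCenter N (c + 1), N⁆ ≤ relCenter N c := by
  rw [Subgroup.commutator_le]
  intro g hg n hn
  have := (mem_relCenter_succ.1 (inv_mem hg)).2 _ (inv_mem hn)
  simpa [comm_eq_commutatorElement] using this

theorem lowerCentralSeries_le_relCenter {N H : Subgroup G} (hHN : H ≤ N) {c i₀ : ℕ}
    (h : H.lowerCentralSeries i₀ ≤ relCenter N c) (i : ℕ) :
    H.lowerCentralSeries (i₀ + i) ≤ relCenter N (c - i) := by
  induction i with
  | zero => exact h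
  | succ i ih =>
    rw [← add_assoc, Subgroup.lowerCentralSeries_succ]
    rcases Nat.lt_or_ge i c with hi | hi
    · obtain ⟨k, hk⟩ : ∃ k, c - i = k + 1 := ⟨c - i - 1, by omega⟩
      rw [hk] at ih
      have : c - (i + 1) = k := by omega
      rw [this]
      exact (Subgroup.commutator_mono ih hHN).trans (commutator_relCenter_le N k)
    · have h0 : c - i = 0 := by omega
      rw [h0, relCenter_zero, le_bot_iff] at ih
      rw [ih, Subgroup.commutator_bot_left]
      exact bot_le

theorem lowerCentralSeries_relCenter (N : Subgroup G) (c : ℕ) :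
    (relCenter N c).lowerCentralSeries c = ⊥ := by
  have := lowerCentralSeries_le_relCenter (relCenter_le N c) (c := c) (i₀ := 0) le_rfl c
  simpa [relCenter_zero] using this

theorem Tail.mem_relCenter {N E : Subgroup G} {c : ℕ} (hE : E ≤ relCenter N c) {L : List G} {g : G}
    (h : Tail N E L g) : g ∈ relCenter N (L.length + c) := by
  induction L generalizing g with
  | nil => simpa using hE h
  | cons x L ih =>
    rw [List.length_cons, add_right_comm]
    exact mem_relCenter_succ.2 ⟨h.1, fun n hn => ih (h.2.2 n hn)⟩

/-- Modulo `relCenter N c` the subgroup `relCenter N (c + 1)` is central in `N`, so adjoining one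
element `n` still gives an abelian quotient and the class does not grow. -/
theorem lowerCentralSeries_sup_zpowers {N : Subgroup G} (hN : N.Normal) {n : G} (hn : n ∈ N)
    (c : ℕ) : (relCenter N (c + 1) ⊔ Subgroup.zpowers n).lowerCentralSeries (c + 1) = ⊥ := by
  set K := relCenter N (c + 1) with hK
  set H := K ⊔ Subgroup.zpowers n with hH
  have hHN : H ≤ N := sup_le (relCenter_le N _) (by simpa using hn)
  have hW : (relCenter N c).Normal := relCenter_normal hN c
  set π := QuotientGroup.mk' (relCenter N c) with hπ
  have hcomm : ∀ g h : G, π g * π h = π h * π g ↔ comm g h ∈ relCenter N c := by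
    intro g h
    rw [← map_mul, ← map_mul, eq_comm, hπ, QuotientGroup.mk'_apply, QuotientGroup.mk'_apply,
      QuotientGroup.eq, comm, mul_inv_rev, ← mul_assoc]
  have h1 : ∀ g ∈ K, ∀ h ∈ N, π g * π h = π h * π g := fun g hg h hh =>
    (hcomm g h).2 ((mem_relCenter_succ.1 hg).2 h hh)
  have h2 : H ≤ (Subgroup.centralizer {π n}).comap π := by
    refine sup_le (fun g hg => ?_) ?_
    · rw [Subgroup.mem_comap, Subgroup.mem_centralizer_singleton_iff]
      exact (h1 g hg n hn)
    · rw [Subgroup.zpowers_le, Subgroup.mem_comap, Subgroup.mem_centralizer_singleton_iff]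
  have h3 : ∀ h ∈ H, H ≤ (Subgroup.centralizer {π h}).comap π := by
    intro h hh
    refine sup_le (fun g hg => ?_) ?_
    · rw [Subgroup.mem_comap, Subgroup.mem_centralizer_singleton_iff]
      exact (h1 g hg h (hHN hh))
    · rw [Subgroup.zpowers_le, Subgroup.mem_comap, Subgroup.mem_centralizer_singleton_iff]
      have := h2 hh
      rw [Subgroup.mem_comap, Subgroup.mem_centralizer_singleton_iff] at this
      exact this.symm
  have h4 : H.lowerCentralSeries 1 ≤ relCenter N c := by
    change ⁅H, H⁆ ≤ _
    rw [Subgroup.commutator_le]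
    intro g hg h hh
    have := h3 _ (inv_mem hh) (inv_mem hg)
    rw [Subgroup.mem_comap, Subgroup.mem_centralizer_singleton_iff, hcomm] at this
    simpa [comm_eq_commutatorElement] using this
  have := lowerCentralSeries_le_relCenter hHN h4 c
  rw [Nat.sub_self, relCenter_zero, le_bot_iff, add_comm] at this
  exact this

end UpperCentral

/-! ### Index bounds for verbal subgroups. -/

section Index

variable {G : Type*} [Group G]

/-- By Schreier, `N` needs at most `N.index * r` generators, and `N` modulo `verb e N` is abelian of
exponent dividing `e`. -/
theorem index_verb_le {r : ℕ} (hG : IsGeneratedBy G r) {N : Subgroup G} (h0 : N.index ≠ 0)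
    {e : ℕ} (he : 0 < e) :
    (verb e N).index ≠ 0 ∧ (verb e N).index ≤ e ^ (N.index * r) * N.index := by
  classical
  obtain ⟨gen, hgen⟩ := hG
  have hfg : Group.FG G := Group.fg_iff.2 ⟨_, hgen, Set.finite_range gen⟩
  have hr : Group.rank G ≤ r := by
    have h1 : Subgroup.closure ((Finset.univ.image gen : Finset G) : Set G) = ⊤ := by
      simpa using hgen
    exact (Group.rank_le h1).trans (Finset.card_image_le.trans (by simp))
  have hfi : N.FiniteIndex := ⟨h0⟩
  set W := (verb e N).subgroupOf N with hW
  have hcomm : ∀ g h : N, comm g h ∈ W := fun g h =>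
    Subgroup.subset_closure (Or.inr ⟨g, g.2, h, h.2, rfl⟩)
  have hWn : W.Normal := ⟨fun n hn g => by
    have e1 : g * n * g⁻¹ = n * comm n g⁻¹ := by rw [mul_comm_eq_conj, inv_inv]
    rw [e1]
    exact W.mul_mem hn (hcomm _ _)⟩
  let _ : CommGroup (N ⧸ W) :=
    { (inferInstance : Group (N ⧸ W)) with
      mul_comm := by
        intro a b
        induction a using QuotientGroup.induction_on with | _ a =>
        induction b using QuotientGroup.induction_on with | _ b =>
        rw [← QuotientGroup.mk_mul, ← QuotientGroup.mk_mul, QuotientGroup.eq]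
        have := hcomm b a
        rwa [comm, mul_assoc, mul_assoc, ← mul_assoc, ← mul_inv_rev] at this }
  have hfgN : Group.FG N := Subgroup.fg_of_index_ne_zero N
  have hfgQ : Group.FG (N ⧸ W) := QuotientGroup.fg W
  have h1 : Nat.card (N ⧸ W) ∣ e ^ Group.rank (N ⧸ W) := by
    refine card_dvd_exponent_pow_rank' (N ⧸ W) fun a => ?_
    induction a using QuotientGroup.induction_on with | _ a =>
    rw [← QuotientGroup.mk_pow, QuotientGroup.eq_one_iff]
    exact Subgroup.subset_closure (Or.inl ⟨a, a.2, rfl⟩)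
  have h2 : Group.rank (N ⧸ W) ≤ Group.rank N :=
    Group.rank_le_of_surjective (QuotientGroup.mk' W) (QuotientGroup.mk'_surjective W)
  have h3 : Group.rank N ≤ N.index * r :=
    (Subgroup.rank_le_index_mul_rank N).trans (Nat.mul_le_mul_left _ hr)
  have h4 : Nat.card (N ⧸ W) ≤ e ^ (N.index * r) :=
    (Nat.le_of_dvd (pow_pos he _) h1).trans (Nat.pow_le_pow_right he (h2.trans h3))
  have h5 : Nat.card (N ⧸ W) ≠ 0 := fun h => by
    rw [h, zero_dvd_iff] at h1
    exact (pow_pos he _).ne' h1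
  have h6 : Nat.card (N ⧸ W) * N.index = (verb e N).index :=
    Subgroup.relIndex_mul_index (verb_le e N)
  rw [← h6]
  exact ⟨Nat.mul_ne_zero h5 h0, Nat.mul_le_mul_right _ h4⟩

/-- A bound for the index of an iterated verbal subgroup. -/
def verbBound (e r i : ℕ) : ℕ → ℕ
  | 0 => i
  | p + 1 => e ^ (verbBound e r i p * r) * verbBound e r i p

theorem index_verb_iterate_le {r : ℕ} (hG : IsGeneratedBy G r) {N : Subgroup G}
    (h0 : N.index ≠ 0) {i : ℕ} (hi : N.index ≤ i) {e : ℕ} (he : 0 < e) (p : ℕ) :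
    ((verb e)^[p] N).index ≠ 0 ∧ ((verb e)^[p] N).index ≤ verbBound e r i p := by
  induction p with
  | zero => exact ⟨h0, hi⟩
  | succ p ih =>
    rw [Function.iterate_succ_apply']
    obtain ⟨h1, h2⟩ := index_verb_le hG ih.1 he
    exact ⟨h1, h2.trans (Nat.mul_le_mul (Nat.pow_le_pow_right he (Nat.mul_le_mul_right r ih.2))
      ih.2)⟩

end Index

/-! ### Commutators of maximal order and their centralizer. -/

section MaximalOrder

variable {G : Type*} [Group G]

theorem longComm_map {H : Type*} [Group H] (f : G →* H) (l : ℕ) (x : Fin l → G) :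
    longComm l (fun i => f (x i)) = f (longComm l x) := by
  induction l with
  | zero => simp [longComm]
  | succ l ih =>
    cases l with
    | zero => rfl
    | succ l =>
      simp only [longComm, comm, map_mul, map_inv]
      rw [ih]

theorem eorder_map {H : Type*} [Group H] (f : G →* H) (hf : Function.Injective f) (g : G) :
    eorder (f g) = eorder g := by
  rw [eorder, eorder, ← MonoidHom.map_zpowers]
  exact ENat.card_congr ((Subgroup.zpowers g).equivMapOfInjective f hf).toEquiv.symm

theorem conj_mem_maxComms {l : ℕ} {d : G} (hd : d ∈ maxComms G l) (g : G) :
    g * d * g⁻¹ ∈ maxComms G l := by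
  obtain ⟨⟨x, rfl⟩, hmax⟩ := hd
  have e : eorder (g * longComm l x * g⁻¹) = eorder (longComm l x) :=
    eorder_map (MulAut.conj g).toMonoidHom (MulAut.conj g).injective _
  refine ⟨⟨fun i => g * x i * g⁻¹, longComm_map (MulAut.conj g).toMonoidHom l x⟩, fun c hc => ?_⟩
  rw [e]
  exact hmax c hc

theorem closure_maxComms_normal (l : ℕ) : (Subgroup.closure (maxComms G l)).Normal := by
  refine ⟨fun d hd g => ?_⟩
  have : Subgroup.closure (maxComms G l) ≤
      (Subgroup.closure (maxComms G l)).comap (MulAut.conj g).toMonoidHom := by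
    rw [Subgroup.closure_le]
    intro d hd
    exact Subgroup.subset_closure (conj_mem_maxComms hd g)
  exact this hd

/-- This centralizer is the kernel of the conjugation action on the `m` elements of `𝒟_l`. -/
theorem centralizer_maxComms_index {l m : ℕ} (hm : (maxComms G l).encard = m) :
    (Subgroup.centralizer (maxComms G l)).Normal ∧
    (Subgroup.centralizer (maxComms G l)).index ≠ 0 ∧
    (Subgroup.centralizer (maxComms G l)).index ≤ m.factorial := by
  classical
  have hfin : (maxComms G l).Finite := Set.finite_of_encard_eq_coe hm
  have : Fintype (maxComms G l) := hfin.fintype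
  let f : G →* Equiv.Perm (maxComms G l) :=
    { toFun := fun g =>
        { toFun := fun d => ⟨g * d * g⁻¹, conj_mem_maxComms d.2 g⟩
          invFun := fun d => ⟨g⁻¹ * d * g, by simpa using conj_mem_maxComms d.2 g⁻¹⟩
          left_inv := fun d => Subtype.ext (by simp [mul_assoc])
          right_inv := fun d => Subtype.ext (by simp [mul_assoc]) }
      map_one' := by ext d; simp
      map_mul' := fun a b => by ext d; simp [mul_assoc] }
  have hf : Subgroup.centralizer (maxComms G l) = f.ker := by
    ext g
    rw [MonoidHom.mem_ker, Subgroup.mem_centralizer_iff]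
    constructor
    · intro h
      ext d
      change g * d * g⁻¹ = d
      rw [← h d d.2, mul_inv_cancel_right]
    · intro h d hd
      have : g * d * g⁻¹ = d := congrArg Subtype.val (DFunLike.congr_fun h ⟨d, hd⟩)
      rw [mul_inv_eq_iff_eq_mul] at this
      exact this.symm
  rw [hf, Subgroup.index_ker]
  refine ⟨inferInstance, Nat.card_pos.ne', ?_⟩
  refine (Nat.card_le_card_of_injective _ Subtype.val_injective).trans ?_
  rw [Nat.card_eq_fintype_card, Fintype.card_perm]
  have : Fintype.card (maxComms G l) = m := by
    have h := hfin.encard_eq_coe_toFinset_card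
    rw [hm] at h
    rw [← Set.toFinset_card]
    simpa using (Nat.cast_inj.1 h).symm
  rw [this]

theorem eorder_of_orderOf_ne_zero {g : G} (h : orderOf g ≠ 0) : eorder g = orderOf g := by
  have : Finite (Subgroup.zpowers g) := Nat.finite_of_card_ne_zero (by rwa [Nat.card_zpowers])
  rw [eorder, ENat.card_eq_coe_natCard, Nat.card_zpowers]

theorem eorder_of_orderOf_eq_zero {g : G} (h : orderOf g = 0) : eorder g = ⊤ := by
  rw [eorder, ENat.card_eq_top]
  rw [← Nat.card_zpowers] at h
  rcases Nat.card_eq_zero.1 h with h | h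
  · exact (h.false 1).elim
  · exact h

theorem orderOf_of_eorder_le {c d : G} (h : eorder c ≤ eorder d) :
    orderOf d = 0 ∨ (orderOf c ≠ 0 ∧ orderOf c ≤ orderOf d) := by
  by_cases hd : orderOf d = 0
  · exact Or.inl hd
  right
  rw [eorder_of_orderOf_ne_zero hd] at h
  by_cases hc : orderOf c = 0
  · rw [eorder_of_orderOf_eq_zero hc] at h
    simp at h
  · rw [eorder_of_orderOf_ne_zero hc] at h
    exact ⟨hc, by exact_mod_cast h⟩

theorem eorder_eq_of_orderOf_eq {c d : G} (h : orderOf c = orderOf d) : eorder c = eorder d := by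
  by_cases hd : orderOf d = 0
  · rw [eorder_of_orderOf_eq_zero hd, eorder_of_orderOf_eq_zero (h.trans hd)]
  · rw [eorder_of_orderOf_ne_zero hd, eorder_of_orderOf_ne_zero (h ▸ hd), h]

end MaximalOrder

/-! ### Bounding orders through the maximality of the order of `d`. -/

section Order

variable {G : Type*} [Group G]

/-- Right multiplication by `d` injects the values `F j` with `F j * d` of maximal order into `𝒟_l`,
so there are at most `m` of them and the additive estimate applies in `A`. -/
theorem pow_polyExp_eq_one {l m : ℕ} (hm : (maxComms G l).encard = m) {d : G}
    (hd : d ∈ maxComms G l) (A : Subgroup G) (hA : ∀ a ∈ A, ∀ b ∈ A, a * b = b * a) (hdA : d ∈ A)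
    {q : ℕ} {F : ℕ → G} (hFA : ∀ j, F j ∈ A) (hF : seqDiff^[q + 1] F = 1) (h0 : F 0 = 1)
    (hlong : ∀ j, F j * d ∈ longComms G l) (j : ℕ) : F j ^ polyExp m q = 1 := by
  classical
  let _ : CommGroup A :=
    { (inferInstance : Group A) with mul_comm := fun a b => Subtype.ext (hA a a.2 b b.2) }
  set F' : ℕ → Additive A := fun j => Additive.ofMul ⟨F j, hFA j⟩ with hF'
  set d' : Additive A := Additive.ofMul ⟨d, hdA⟩ with hd'
  have hdiff : ∀ i j, ((((fwdDiff 1)^[i] F' j).toMul : A) : G) = seqDiff^[i] F j := by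
    intro i
    induction i with
    | zero => exact fun j => rfl
    | succ i ih =>
      intro j
      rw [Function.iterate_succ_apply', Function.iterate_succ_apply', fwdDiff, toMul_sub, div_eq_mul_inv,
        mul_comm, Subgroup.coe_mul, Subgroup.coe_inv, ih, ih, seqDiff]
  have hzero : (fwdDiff 1)^[q + 1] F' = 0 := by
    funext j
    refine Additive.toMul.injective (Subtype.ext ?_)
    rw [hdiff, hF]
    rfl
  have hord : ∀ j, addOrderOf (d' + F' j) = orderOf (F j * d) := by
    intro j
    rw [← Subgroup.orderOf_mk _ (A.mul_mem (hFA j) hdA), ← addOrderOf_ofMul_eq_orderOf]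
    congr 1
    rw [add_comm]
    rfl
  have hord' : addOrderOf d' = orderOf d := by
    rw [← Subgroup.orderOf_mk d hdA, ← addOrderOf_ofMul_eq_orderOf]
  have hfin : (maxComms G l).Finite := Set.finite_of_encard_eq_coe hm
  set φ : Additive A → G := fun a => (a.toMul : G) * d with hφ
  have hφinj : Function.Injective φ := fun a b hab =>
    Additive.toMul.injective (Subtype.ext (mul_right_cancel hab))
  have hV := hfin.preimage hφinj.injOn
  have hcard : hfin.toFinset.card = m := by
    rw [hfin.encard_eq_coe_toFinset_card] at hm
    exact_mod_cast hm
  have key := polyExp_smul_eq_zero_of_addOrderOf_le (m := m) hzero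
    (Additive.toMul.injective (Subtype.ext h0)) d'
    (fun j => by
      rw [hord, hord']
      exact orderOf_of_eorder_le (hd.2 _ (hlong j)))
    hV.toFinset
    (by
      rw [← hcard]
      refine Finset.card_le_card_of_injOn φ (fun a ha => ?_) hφinj.injOn
      simpa using ha)
    (fun j hj => by
      rw [hord, hord'] at hj
      rw [Set.Finite.mem_toFinset]
      refine ⟨hlong j, fun c hc => ?_⟩
      change eorder c ≤ eorder (F j * d)
      rw [eorder_eq_of_orderOf_eq hj]
      exact hd.2 c hc)
    j
  exact congrArg (fun a : Additive A => (a.toMul : G)) key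

end Order

/-! ### Substitutions into a long commutator. -/

section Lists

variable {G : Type*} [Group G]

/-- The left-normed commutator of a list. -/
def listComm : List G → G
  | [] => 1
  | x :: L => L.foldl comm x

theorem listComm_append {Q : List G} (hQ : Q ≠ []) (L : List G) :
    listComm (Q ++ L) = L.foldl comm (listComm Q) := by
  cases Q with
  | nil => exact absurd rfl hQ
  | cons q Q => simp [listComm, List.foldl_append]

theorem listComm_append_singleton {Q : List G} (hQ : Q ≠ []) (z : G) :
    listComm (Q ++ [z]) = comm (listComm Q) z := by
  rw [listComm_append hQ]; rfl

theorem listComm_append_cons (Q : List G) (z : G) (L : List G) :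
    listComm (Q ++ z :: L) = L.foldl comm (listComm (Q ++ [z])) := by
  rw [← listComm_append (by simp), List.append_assoc, List.singleton_append]

theorem longComm_eq_listComm (l : ℕ) (x : Fin l → G) : longComm l x = listComm (List.ofFn x) := by
  induction l with
  | zero => simp [longComm, listComm]
  | succ l ih =>
    cases l with
    | zero => simp [longComm, listComm]
    | succ l =>
      rw [List.ofFn_succ_last, listComm_append_singleton (by simp [List.ofFn_succ]), ← ih]
      rfl

theorem listComm_mem_longComms (ws : List G) : listComm ws ∈ longComms G ws.length :=
  ⟨ws.get, by rw [longComm_eq_listComm, List.ofFn_get]⟩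

theorem foldl_comm_conj (n g : G) (L : List G) :
    L.foldl comm (n⁻¹ * g * n) = n⁻¹ * (L.map fun z => n * z * n⁻¹).foldl comm g * n := by
  induction L generalizing g with
  | nil => rfl
  | cons z L ih => rw [List.foldl_cons, comm_conj_left, ih, List.map_cons, List.foldl_cons]

theorem coset_map_conj {N : Subgroup G} (hN : N.Normal) {n : G} (hn : n ∈ N) {L zs : List G}
    (h : List.Forall₂ (fun x z => x⁻¹ * z ∈ N) L zs) :
    List.Forall₂ (fun x z => x⁻¹ * z ∈ N) L (zs.map fun z => n * z * n⁻¹) := by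
  rw [List.forall₂_map_right_iff]
  refine h.imp fun x z hz => ?_
  have e : x⁻¹ * (n * z * n⁻¹) = (x⁻¹ * n * x) * (x⁻¹ * z) * n⁻¹ := by group
  rw [e]
  exact N.mul_mem (N.mul_mem (conj_mem_of_normal hN hn x) hz) (N.inv_mem hn)

theorem foldl_comm_mem {N : Subgroup G} (hN : N.Normal) {g : G} (hg : g ∈ N) (L : List G) :
    L.foldl comm g ∈ N := by
  induction L generalizing g with
  | nil => exact hg
  | cons z L ih => exact ih (comm_mem_left hN hg z)

/-- Substituting an element of `N` for the `j`-th entry of `xs`, `j > k`, and elements of `N` for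
some of the later entries, always gives the trivial commutator. -/
def KilledAfter (N : Subgroup G) (xs : List G) (k : ℕ) : Prop :=
  ∀ P x L, xs = P ++ x :: L → k ≤ P.length → ∀ n ∈ N, Tail N ⊥ L (listComm (P ++ [n]))

theorem KilledAfter.listComm_eq_one {N : Subgroup G} {Q L W : List G}
    (h : KilledAfter N (Q ++ L) Q.length)
    (hW : List.Forall₂ (fun x w => w = x ∨ w ∈ N) L W) (hex : ∃ w ∈ W, w ∈ N) :
    listComm (Q ++ W) = 1 := by
  induction hW generalizing Q with
  | nil => simp at hex
  | @cons x w L W hw hW ih =>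
    by_cases hwN : w ∈ N
    · rw [listComm_append_cons]
      exact (h Q x L rfl le_rfl w hwN).foldl_mem hW
    · obtain rfl := hw.resolve_right hwN
      have e : ∀ L : List G, Q ++ w :: L = (Q ++ [w]) ++ L := fun L => by simp
      rw [e]
      refine ih (Q := Q ++ [w]) ?_ ?_
      · intro P x' L' hP hk
        exact h P x' L' (by rw [← hP, e]) (by simp at hk; omega)
      · obtain ⟨u, hu, huN⟩ := hex
        rcases List.mem_cons.1 hu with rfl | hu
        · exact absurd huN hwN
        · exact ⟨u, hu, huN⟩

/-- Writing `z = x (x⁻¹ z)`, the commutator of the product with `z` splits into `[u, z]`, factors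
with trivial tails, and a conjugate by an element of `N` of the next initial commutator. The
parameters `t` and `n` absorb the last two, which closes the induction. -/
theorem KilledAfter.foldl_eq {N : Subgroup G} (hN : N.Normal) {d : G}
    (hd : N ≤ Subgroup.centralizer {d}) {Q L zs : List G} (hQ : Q ≠ [])
    (h : KilledAfter N (Q ++ L) Q.length) (hQd : listComm (Q ++ L) = d)
    (hzs : List.Forall₂ (fun x z => x⁻¹ * z ∈ N) L zs)
    {u t n : G} (hu : u ∈ N) (ht : Tail N ⊥ L t) (hn : n ∈ N) :
    zs.foldl comm (u * t * (n⁻¹ * listComm Q * n)) = zs.foldl comm u * d := by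
  have hdn : ∀ n ∈ N, n⁻¹ * d * n = d := by
    intro n hn
    have := Subgroup.mem_centralizer_singleton_iff.1 (hd hn)
    rw [mul_assoc, ← this, inv_mul_cancel_left]
  induction L generalizing Q zs u t n with
  | nil =>
    cases hzs
    have ht' : t = 1 := ht
    rw [List.append_nil] at hQd
    simp only [List.foldl_nil]
    rw [hQd, hdn n hn, ht', mul_one]
  | cons x L ih =>
    -- The conjugation by `n` is moved outside; the conjugated entries stay in their cosets of `N`,
    -- and `n` commutes with `d`.
    have e0 : u * t * (n⁻¹ * listComm Q * n) =
        n⁻¹ * ((n * u * n⁻¹) * (n * t * n⁻¹) * listComm Q) * n := by group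
    rw [e0, foldl_comm_conj]
    have hzs' := coset_map_conj hN hn hzs
    have e00 : zs.foldl comm u =
        n⁻¹ * (zs.map fun z => n * z * n⁻¹).foldl comm (n * u * n⁻¹) * n := by
      rw [← foldl_comm_conj]; congr 1; group
    rw [e00]
    have hc : n * u * n⁻¹ ∈ N := hN.conj_mem u hu n
    have hs : Tail N ⊥ (x :: L) (n * t * n⁻¹) := by
      have := ht.conj hN (bot_conj_mem N) (inv_mem hn)
      simpa using this
    set c := n * u * n⁻¹ with hcdef
    set s := n * t * n⁻¹ with hsdef
    set a := listComm Q with ha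
    generalize zs.map (fun z => n * z * n⁻¹) = ws at hzs'
    obtain ⟨z, ws, hz, hws, rfl⟩ : ∃ z ws', x⁻¹ * z ∈ N ∧
        List.Forall₂ (fun x z => x⁻¹ * z ∈ N) L ws' ∧ ws = z :: ws' := by
      cases hzs' with
      | cons hz hws => exact ⟨_, _, hz, hws, rfl⟩
    rw [List.foldl_cons, List.foldl_cons]
    have hkill : ∀ v ∈ N, Tail N ⊥ L (comm a v) := fun v hv => by
      rw [← listComm_append_singleton hQ]
      exact h Q x L rfl le_rfl v hv
    set S := tailSubgroup hN (bot_conj_mem N) L with hS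
    have hcz : comm c z ∈ N := comm_mem_left hN hc z
    have hsN : s ∈ N := hs.1
    have hv : comm (comm c z) s * comm s z ∈ S := by
      refine S.mul_mem ?_ (hs.comm_coset hN (bot_conj_mem N) hz)
      have e1 : comm (comm c z) s = (comm s (comm c z))⁻¹ := by simp only [comm]; group
      rw [e1]
      exact S.inv_mem (hs.2.2 _ hcz)
    have hvN : comm (comm c z) s * comm s z ∈ N :=
      Tail.mem bot_le hv
    have e2 : ∀ v, comm v a = (comm a v)⁻¹ := fun v => by simp only [comm]; group
    have htot : comm (comm c z) a * ((comm (comm c z) s * comm s z) *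
        comm (comm (comm c z) s * comm s z) a) * comm a (x⁻¹ * z) ∈ S := by
      refine S.mul_mem (S.mul_mem ?_ (S.mul_mem hv ?_)) (hkill _ hz)
      · rw [e2]; exact S.inv_mem (hkill _ hcz)
      · rw [e2]; exact S.inv_mem (hkill _ hvN)
    have e3 : comm (c * s * a) z = comm c z * (comm (comm c z) a *
        ((comm (comm c z) s * comm s z) * comm (comm (comm c z) s * comm s z) a) *
        comm a (x⁻¹ * z)) * ((x⁻¹ * z)⁻¹ * listComm (Q ++ [x]) * (x⁻¹ * z)) := by
      rw [listComm_append_singleton hQ, ← ha]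
      simp only [comm]; group
    have eQ : ∀ L : List G, Q ++ x :: L = (Q ++ [x]) ++ L := fun L => by simp
    rw [e3, ih (Q := Q ++ [x]) (by simp) ?_ (by rw [← eQ]; exact hQd) hws hcz htot hz]
    · calc n⁻¹ * (ws.foldl comm (comm c z) * d) * n
          = (n⁻¹ * ws.foldl comm (comm c z) * n) * (n⁻¹ * d * n) := by group
        _ = _ := by rw [hdn n hn]
    · intro P x' L' hP hk
      exact h P x' L' (by rw [← hP, eQ]) (by simp at hk; omega)

theorem KilledAfter.exists_listComm_eq {N : Subgroup G} (hN : N.Normal) {d : G}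
    (hd : N ≤ Subgroup.centralizer {d}) {P L zs : List G} {x : G}
    (h : KilledAfter N (P ++ x :: L) (P.length + 1)) (hQd : listComm (P ++ x :: L) = d)
    (hzs : List.Forall₂ (fun x z => x⁻¹ * z ∈ N) L zs) {n : G} (hn : n ∈ N) :
    ∃ n' ∈ N, listComm (P ++ (x * n') :: zs) = zs.foldl comm (listComm (P ++ [n])) * d := by
  have eQ : P ++ x :: L = (P ++ [x]) ++ L := by simp
  have h' : KilledAfter N ((P ++ [x]) ++ L) (P ++ [x]).length := by
    rw [← eQ]; simpa using h
  have h1 := (Tail.closure_props hN (bot_conj_mem N) L).1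
  rw [eQ] at hQd
  rcases eq_or_ne P [] with rfl | hP
  · refine ⟨x⁻¹ * n * x, conj_mem_of_normal hN hn x, ?_⟩
    have := h'.foldl_eq hN hd (by simp) hQd hzs hn h1 (one_mem N)
    simp only [List.nil_append, listComm, List.foldl_nil, mul_one, inv_one, one_mul] at this ⊢
    rw [← this]
    congr 1
    group
  · refine ⟨n, hn, ?_⟩
    rw [listComm_append_cons, listComm_append_singleton hP, listComm_append_singleton hP,
      comm_mul_right]
    have := h'.foldl_eq hN hd (by simp) hQd hzs (comm_mem_right hN (listComm P) hn) h1 hn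
    rw [listComm_append_singleton hP, mul_one] at this
    exact this

/-- Stability in terms of lists. -/
theorem IsStable.listComm_mem {l : ℕ} {x : Fin l → G} (hx : IsStable x) {P L : List G} {a : G}
    (hxs : List.ofFn x = P ++ a :: L) {N : Subgroup G} (hN : N.Normal)
    (hd : N ≤ Subgroup.centralizer {longComm l x}) (h : KilledAfter N (List.ofFn x) (P.length + 1))
    {n : G} (hn : n ∈ N) {zs : List G} (hzs : List.Forall₂ (fun x z => x⁻¹ * z ∈ N) L zs) :
    listComm (P ++ (a * n) :: zs) ∈ Subgroup.closure (maxComms G l) := by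
  have hlen : l = P.length + (L.length + 1) := by
    have := congrArg List.length hxs
    simpa using this
  have hzl : zs.length = L.length := hzs.length_eq.symm
  have hxi : ∀ (i : ℕ) (hi : i < l), x ⟨i, hi⟩ = (P ++ a :: L)[i]'(by simp; omega) := by
    intro i hi
    have : (List.ofFn x)[i]'(by simpa using hi) = x ⟨i, hi⟩ := List.getElem_ofFn _
    rw [← this]
    simp only [hxs]
  set ws := P ++ (a * n) :: zs with hws
  have hwl : ws.length = l := by simp [hws]; omega
  -- The one-based position of `a` is `P.length + 1`. From there on `y i = x_i⁻¹ w_i` turns `x_i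
  -- y_i` into the prescribed entry; the earlier values `1` are never used.
  have hstab := hx (P.length + 1) (by omega) N hN hd ?_ (Finset.Icc (P.length + 1 + 1) l)
    (Finset.Subset.refl _)
    (fun i => if P.length ≤ (i : ℕ) then (x i)⁻¹ * ws[(i : ℕ)]'(by omega) else 1) ?_
  · convert! hstab using 1
    rw [subst, longComm_eq_listComm]
    congr 1
    refine List.ext_getElem (by simpa using hwl) fun i h1 h2 => ?_
    rw [List.getElem_ofFn]
    simp only [Finset.mem_insert, Finset.mem_Icc]
    have hil : i < l := by omega
    by_cases hi : P.length ≤ i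
    · rw [if_pos (by omega), if_pos hi, mul_inv_cancel_left]
    · rw [if_neg (by omega), hxi i hil]
      simp only [hws]
      rw [List.getElem_append_left (by omega), List.getElem_append_left (by omega)]
  · intro I hI hne y hy
    rw [subst, longComm_eq_listComm]
    set f : Fin l → G := fun i => if (i : ℕ) + 1 ∈ I then y i else x i with hf
    have e1 : List.ofFn f = (P ++ [a]) ++ (List.ofFn f).drop (P.length + 1) := by
      conv_lhs => rw [← List.take_append_drop (P.length + 1) (List.ofFn f)]
      congr 1
      refine List.ext_getElem (by simp; omega) fun i h1 h2 => ?_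
      have hi : i < P.length + 1 := by simpa using h2
      have hil : i < l := by omega
      rw [List.getElem_take, List.getElem_ofFn]
      change (if i + 1 ∈ I then _ else _) = _
      have hnot : ¬ (i + 1 ∈ I) := fun hc => by
        have := Finset.mem_Icc.1 (hI hc)
        omega
      rw [if_neg hnot, hxi i hil]
      simp only [show P ++ a :: L = (P ++ [a]) ++ L by simp]
      rw [List.getElem_append_left (by simpa using hi)]
    rw [e1]
    refine KilledAfter.listComm_eq_one (N := N) (L := L) ?_ ?_ ?_
    · have : (P ++ [a]) ++ L = List.ofFn x := by rw [hxs]; simp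
      rw [this]
      simpa using h
    · rw [List.forall₂_iff_get]
      refine ⟨by simp; omega, fun i h1 h2 => ?_⟩
      have hil : P.length + 1 + i < l := by omega
      simp only [List.get_eq_getElem, List.getElem_drop, List.getElem_ofFn, hf]
      split_ifs
      · exact Or.inr (hy _)
      · left
        rw [hxi _ hil]
        simp only [show P ++ a :: L = (P ++ [a]) ++ L by simp]
        rw [List.getElem_append_right (by simp)]
        congr 1
        simp
    · obtain ⟨k, hk⟩ := hne
      have hk' := Finset.mem_Icc.1 (hI hk)
      have hkl : k - 1 < l := by omega
      refine ⟨f ⟨k - 1, hkl⟩, ?_, ?_⟩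
      · rw [List.mem_iff_getElem]
        refine ⟨k - 1 - (P.length + 1), by simp; omega, ?_⟩
        rw [List.getElem_drop, List.getElem_ofFn]
        congr 1
        apply Fin.ext
        simp only
        omega
      · have hk1 : k - 1 + 1 = k := by omega
        simp only [hf, hk1, if_pos hk]
        exact hy _
  · intro i
    split_ifs with hi
    · rw [show i = ⟨i, i.2⟩ from rfl, hxi i i.2]
      simp only [hws]
      rw [List.getElem_append_right hi, List.getElem_append_right hi]
      rcases Nat.eq_zero_or_pos ((i : ℕ) - P.length) with h0 | h0
      · simp only [h0, List.getElem_cons_zero]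
        simpa using hn
      · obtain ⟨j, hj⟩ : ∃ j, (i : ℕ) - P.length = j + 1 := ⟨(i : ℕ) - P.length - 1, by omega⟩
        simp only [hj, List.getElem_cons_succ]
        exact (List.forall₂_iff_get.1 hzs).2 j (by omega) (by omega)
    · exact one_mem N

end Lists

/-! ### The descent through the positions. -/

section Main

variable {G : Type*} [Group G]

theorem seqDiff_iterate_pow (n : G) (q : ℕ) : seqDiff^[q + 2] (fun j => n ^ j) = 1 := by
  have h1 : seqDiff (fun j => n ^ j) = fun _ => n := by
    funext j; simp [seqDiff, pow_succ]
  have h2 : seqDiff (fun _ : ℕ => n) = 1 := by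
    funext j; simp [seqDiff]
  have h3 : ∀ q, seqDiff^[q] (1 : ℕ → G) = 1 := by
    intro q
    induction q with
    | zero => rfl
    | succ q ih =>
      rw [Function.iterate_succ_apply']
      rw [ih]
      funext j; simp [seqDiff]
  rw [Function.iterate_succ_apply, Function.iterate_succ_apply, h1, h2, h3]

theorem listComm_append_singleton_mem {N : Subgroup G} (hN : N.Normal) (P : List G) {n : G}
    (hn : n ∈ N) : listComm (P ++ [n]) ∈ N := by
  rcases eq_or_ne P [] with rfl | hP
  · exact hn
  · rw [listComm_append_singleton hP]
    exact comm_mem_right hN _ hn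

theorem listComm_append_singleton_mul (P : List G) (n n' : G) :
    (listComm (P ++ [n]) * listComm (P ++ [n']))⁻¹ * listComm (P ++ [n * n']) = 1 ∨
    (listComm (P ++ [n]) * listComm (P ++ [n']))⁻¹ * listComm (P ++ [n * n']) =
      comm (listComm (P ++ [n'])) (listComm (P ++ [n])) * comm (listComm (P ++ [n])) n' := by
  rcases eq_or_ne P [] with rfl | hP
  · left
    exact inv_mul_cancel _
  · right
    simp only [listComm_append_singleton hP]
    exact comm_mul_right_quotient _ _ _

/-- The sequence `j ↦ [a, n ^ j, z₁, …, z_k]` is polynomial when `[a, N]` lies in a finite term of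
the upper central series of `N`. -/
theorem seqDiff_iterate_foldl {N : Subgroup G} (hN : N.Normal) {c : ℕ} (P : List G) {n : G}
    (hn : n ∈ N) (hK : ∀ n ∈ N, listComm (P ++ [n]) ∈ relCenter N (c + 1)) (zs : List G) :
    seqDiff^[(c + 1) ^ 2 + 1] (fun j => zs.foldl comm (listComm (P ++ [n ^ j]))) = 1 := by
  have hg : seqDiff^[c + 1 + 1] (fun j => listComm (P ++ [n ^ j])) = 1 := by
    rcases eq_or_ne P [] with rfl | hP
    · exact seqDiff_iterate_pow n c
    · obtain ⟨S, hS1, -, hS3⟩ := exists_polySeq_subgroup _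
        (lowerCentralSeries_sup_zpowers hN hn c) one_pos
      rw [one_mul] at hS3
      set H := relCenter N (c + 1) ⊔ Subgroup.zpowers n with hH
      set a := listComm P with ha
      have hnH : n ∈ H := Subgroup.mem_sup_right (Subgroup.mem_zpowers n)
      -- `[a, n ^ j]` is the inverse of `(a⁻¹ n a) ^ j` times `n ^ j`, a product of two sequences of
      -- degree one in the nilpotent group `H`.
      have huH : a⁻¹ * n * a ∈ H := by
        have h1 : comm a n ∈ H := Subgroup.mem_sup_left (by
          have := hK n hn
          rwa [listComm_append_singleton hP] at this)
        have h2 := H.mul_mem hnH (H.inv_mem h1)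
        have e : n * (comm a n)⁻¹ = a⁻¹ * n * a := by simp only [comm]; group
        rwa [e] at h2
      have hpow : ∀ u ∈ H, (fun j => u ^ j) ∈ S := fun u hu =>
        hS1 _ (fun j => H.pow_mem hu j) (seqDiff_iterate_pow u 0)
      refine hS3 _ ?_
      convert! S.mul_mem (S.inv_mem (hpow _ huH)) (hpow _ hnH) using 1
      funext j
      rw [listComm_append_singleton hP, Pi.mul_apply, Pi.inv_apply]
      have e : (a⁻¹ * n * a) ^ j = a⁻¹ * n ^ j * a := by
        have := conj_pow (i := j) (a := a⁻¹) (b := n)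
        rwa [inv_inv] at this
      rw [e, ← ha]
      simp only [comm]; group
  -- Forming `[g, z] = g⁻¹ g^z` requires stability under conjugation, so the work moves from `H` to
  -- the normal subgroup `relCenter N (c + 1)`. Degree `c + 1` and class at most `c + 1` give the
  -- exponent `(c + 1) ^ 2`.
  obtain ⟨S, hS1, hS2, hS3⟩ := exists_polySeq_subgroup _ (lowerCentralSeries_relCenter N (c + 1))
    (Nat.succ_pos c)
  rw [sq]
  refine hS3 _ ?_
  have h0 := hS1 _ (fun j => hK _ (N.pow_mem hn j)) hg
  suffices H : ∀ g ∈ S, (fun j => zs.foldl comm (g j)) ∈ S from H _ h0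
  clear h0 hg
  induction zs with
  | nil => exact fun g hg => hg
  | cons z zs ih =>
    intro g hg
    refine ih (fun j => comm (g j) z) ?_
    convert! S.mul_mem (S.inv_mem hg) (hS2 (relCenter_normal hN _) z g hg) using 1
    funext j
    simp [comm, mul_assoc]

theorem KilledAfter.step {l m : ℕ} (hm : (maxComms G l).encard = m) {x : Fin l → G}
    (hd : longComm l x ∈ maxComms G l) (hx : IsStable x) {P L : List G} {a : G}
    (hxs : List.ofFn x = P ++ a :: L) {N : Subgroup G} (hN : N.Normal)
    (hNc : N ≤ Subgroup.centralizer (maxComms G l))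
    (h : KilledAfter N (List.ofFn x) (P.length + 1)) :
    KilledAfter ((verb (polyExp m ((L.length + 1) ^ 2)))^[L.length + 1] N) (List.ofFn x)
      P.length := by
  set e := polyExp m ((L.length + 1) ^ 2) with he
  set d := longComm l x with hdd
  set D := Subgroup.closure (maxComms G l) with hD
  have hDn : D.Normal := closure_maxComms_normal l
  have hdD : d ∈ D := Subgroup.subset_closure hd
  have hNd : N ≤ Subgroup.centralizer {d} :=
    hNc.trans (Subgroup.centralizer_le (by simpa using hd))
  have hND : ∀ n ∈ N, ∀ t ∈ D, t * n = n * t := by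
    intro n hn t ht
    have h1 : n ∈ Subgroup.centralizer (D : Set G) := by
      rw [hD, Subgroup.centralizer_closure]
      exact hNc hn
    exact Subgroup.mem_centralizer_iff.1 h1 t ht
  have hlist : listComm (P ++ a :: L) = d := by rw [← hxs, ← longComm_eq_listComm]
  set E₀ := D ⊓ N with hE₀
  have hcent₀ : ∀ g ∈ E₀, ∀ n ∈ N, comm g n = 1 := by
    intro g hg n hn
    have := hND n hn g hg.1
    rw [comm, mul_assoc, this]
    group
  have hconj : ∀ E ≤ E₀, ∀ g ∈ E, ∀ n ∈ N, n⁻¹ * g * n ∈ E := by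
    intro E hE g hg n hn
    rw [← mul_comm_eq_conj, hcent₀ g (hE hg) n hn, mul_one]
    exact hg
  have hval : ∀ n ∈ N, ∀ zs, List.Forall₂ (fun x z => x⁻¹ * z ∈ N) L zs →
      zs.foldl comm (listComm (P ++ [n])) ∈ E₀ ∧
      zs.foldl comm (listComm (P ++ [n])) * d ∈ longComms G l := by
    intro n hn zs hzs
    obtain ⟨n', hn', heq⟩ := KilledAfter.exists_listComm_eq hN hNd (by rw [← hxs]; exact h) hlist
      hzs hn
    have h1 := hx.listComm_mem hxs hN hNd h hn' hzs
    have h2 := listComm_mem_longComms (P ++ (a * n') :: zs)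
    have hlen : (P ++ (a * n') :: zs).length = l := by
      have := congrArg List.length hxs
      have h3 := hzs.length_eq
      simp at this ⊢
      omega
    rw [hlen] at h2
    rw [heq] at h1 h2
    refine ⟨⟨?_, foldl_comm_mem hN (listComm_append_singleton_mem hN P hn) zs⟩, h2⟩
    have := D.mul_mem h1 (D.inv_mem hdD)
    rwa [mul_inv_cancel_right] at this
  -- Since `E₀` is central in `N`, this places `[P, n]` in `relCenter N (L.length + 1)`, which makes
  -- the degree bounded. The tails are then confined further to `E`, the part of `E₀` of exponent
  -- dividing `e`.
  have hT₀ : ∀ n ∈ N, Tail N E₀ L (listComm (P ++ [n])) := fun n hn =>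
    tail_of_cosets hN (hconj E₀ le_rfl) (listComm_append_singleton_mem hN P hn)
      fun zs hzs => (hval n hn zs hzs).1
  have hE₀c : E₀ ≤ relCenter N 1 := fun g hg =>
    mem_relCenter_succ.2 ⟨hg.2, fun n hn => by rw [hcent₀ g hg n hn]; exact one_mem _⟩
  set A := Subgroup.closure (insert d (E₀ : Set G)) with hA
  have hAcomm : ∀ a ∈ A, ∀ b ∈ A, a * b = b * a := by
    have := Subgroup.isMulCommutative_closure (k := insert d (E₀ : Set G)) (by
      rintro a (rfl | ha) b (rfl | hb)
      · rfl
      · exact hND b hb.2 _ hdD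
      · exact (hND a ha.2 _ hdD).symm
      · exact hND b hb.2 _ ha.1)
    intro a ha b hb
    exact congrArg Subtype.val (this.is_comm.comm ⟨a, ha⟩ ⟨b, hb⟩)
  let E : Subgroup G :=
    { carrier := {t | t ∈ E₀ ∧ t ^ e = 1}
      mul_mem' := by
        rintro s t ⟨hs, hs'⟩ ⟨ht, ht'⟩
        refine ⟨E₀.mul_mem hs ht, ?_⟩
        rw [(show Commute s t from hND t ht.2 s hs.1).mul_pow, hs', ht', one_mul]
      one_mem' := ⟨one_mem _, one_pow _⟩
      inv_mem' := by
        rintro s ⟨hs, hs'⟩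
        exact ⟨E₀.inv_mem hs, by rw [inv_pow, hs', inv_one]⟩ }
  have hEE₀ : E ≤ E₀ := fun t ht => ht.1
  have hT : ∀ n ∈ N, Tail N E L (listComm (P ++ [n])) := by
    intro n hn
    refine tail_of_cosets hN (hconj E hEE₀) (listComm_append_singleton_mem hN P hn)
      fun zs hzs => ⟨(hval n hn zs hzs).1, ?_⟩
    have hpoly := seqDiff_iterate_foldl (c := L.length) hN P hn
      (fun n hn => (hT₀ n hn).mem_relCenter hE₀c) zs
    have := pow_polyExp_eq_one hm hd A hAcomm (Subgroup.subset_closure (Set.mem_insert _ _))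
      (fun j => Subgroup.subset_closure
        (Set.mem_insert_of_mem _ (hval _ (N.pow_mem hn j) zs hzs).1)) hpoly
      (by
        rw [pow_zero]
        exact foldl_comm_mem (N := ⊥) inferInstance
          (listComm_append_singleton_mem inferInstance P (one_mem _)) zs)
      (fun j => (hval _ (N.pow_mem hn j) zs hzs).2) 1
    rwa [pow_one] at this
  have hbot := tail_bot_of_mem_verb hN (fun g hg => hcent₀ g (hEE₀ hg)) (fun g hg => hg.2) L
    (fun n => listComm (P ++ [n])) (fun N' hN' n hn => listComm_append_singleton_mem hN' P hn)
    (listComm_append_singleton_mul P) hT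
  intro P' x' L' hP' hk n hn
  rcases hk.eq_or_lt with hk | hk
  · obtain ⟨rfl, h2⟩ := List.append_inj (hxs.symm.trans hP') hk
    obtain ⟨-, rfl⟩ := List.cons_eq_cons.1 h2
    exact hbot n hn
  · exact Tail.restrict (verb_iterate_normal e hN _) (verb_iterate_le e N _)
      (h P' x' L' hP' hk n (verb_iterate_le e N _ hn))
      (listComm_append_singleton_mem (verb_iterate_normal e hN _) P' hn)

/-- Here `t` counts the positions already treated from the end; for `t = 0` the condition is
vacuous. -/
theorem exists_killedAfter (l m r : ℕ) (t : ℕ) (ht : t ≤ l) :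
    ∃ B : ℕ, ∀ (G : Type*) [Group G], IsGeneratedBy G r → (maxComms G l).encard = m →
      ∀ x : Fin l → G, longComm l x ∈ maxComms G l → IsStable x →
        ∃ N : Subgroup G, N.Normal ∧ N ≤ Subgroup.centralizer (maxComms G l) ∧ N.index ≠ 0 ∧
          N.index ≤ B ∧ KilledAfter N (List.ofFn x) (l - t) := by
  induction t with
  | zero =>
    refine ⟨m.factorial, fun G _ _ hm x _ _ => ⟨Subgroup.centralizer (maxComms G l), ?_⟩⟩
    obtain ⟨h1, h2, h3⟩ := centralizer_maxComms_index hm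
    refine ⟨h1, le_rfl, h2, h3, fun P y L hP hk => ?_⟩
    have := congrArg List.length hP
    simp at this
    omega
  | succ t ih =>
    obtain ⟨B, hB⟩ := ih (by omega)
    refine ⟨verbBound (polyExp m ((t + 1) ^ 2)) r B (t + 1), fun G _ hG hm x hd hx => ?_⟩
    obtain ⟨N, hN, hNc, h0, hNB, hk⟩ := hB G hG hm x hd hx
    have hlt : l - (t + 1) < (List.ofFn x).length := by simp; omega
    set P := (List.ofFn x).take (l - (t + 1)) with hP
    set L := (List.ofFn x).drop (l - (t + 1) + 1) with hL
    have hxs : List.ofFn x = P ++ (List.ofFn x)[l - (t + 1)] :: L := by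
      rw [hP, hL, ← List.drop_eq_getElem_cons hlt, List.take_append_drop]
    have hPl : P.length = l - (t + 1) := by simp [hP]
    have hLl : L.length = t := by simp [hL]; omega
    have hk' : l - t = P.length + 1 := by omega
    rw [hk'] at hk
    have key := hk.step hm hd hx hxs hN hNc
    rw [hPl, hLl] at key
    obtain ⟨h1, h2⟩ := index_verb_iterate_le hG h0 hNB (polyExp_pos m ((t + 1) ^ 2)) (t + 1)
    exact ⟨_, verb_iterate_normal _ hN _, (verb_iterate_le _ N _).trans hNc, h1, h2, key⟩

end Main

end LongComm

theorem theorem4p5 (l : ℕ) (hl : 1 ≤ l) (m r : ℕ) :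
    ∃ B : ℕ, ∀ (G : Type*) [Group G], LongComm.IsGeneratedBy G r →
      (LongComm.maxComms G l).encard = m →
      ∀ x : Fin l → G, LongComm.longComm l x ∈ LongComm.maxComms G l →
        LongComm.IsStable x →
        ∃ M : Subgroup G, M.index ≠ 0 ∧ M.index ≤ B ∧
          M.lowerCentralSeries (l - 1) = ⊥ := by
  obtain ⟨B, hB⟩ := LongComm.exists_killedAfter l m r l le_rfl
  refine ⟨B, fun G _ hG hm x hd hx => ?_⟩
  obtain ⟨N, hN, -, h0, hNB, hk⟩ := hB G hG hm x hd hx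
  refine ⟨N, h0, hNB, ?_⟩
  obtain ⟨l, rfl⟩ : ∃ k, l = k + 1 := ⟨l - 1, by omega⟩
  rw [List.ofFn_succ] at hk
  -- With an empty prefix the tails start at `n` itself, so every `n ∈ N` lies in the term of the
  -- upper central series indexed by the number of remaining entries, which is now `l`.
  have hN' : N ≤ LongComm.relCenter N l := by
    intro n hn
    have h1 : LongComm.Tail N ⊥ _ n := hk [] _ _ rfl (by simp) n hn
    have h2 := h1.mem_relCenter (c := 0) bot_le
    simpa using h2
  have := LongComm.lowerCentralSeries_le_relCenter (H := N) (i₀ := 0) le_rfl hN' l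
  rw [Nat.sub_self, LongComm.relCenter_zero, le_bot_iff, zero_add] at this
  exact this
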